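/- **RSLR with pairs.** Aspects are $\square$ (modal) and $\blacksquare$ (non-modal), ordered by $\square<:\square$, $\square<:\blacksquare$, $\blacksquare<:\blacksquare$. Base types are $G::=\mathbf N\mid G\times G$; types are $A::=G\mid aA\to A$ with $a$ an aspect. Subtyping is the reflexive transitive relation generated by: $B<:A$, $C<:D$, $b<:a$ imply $(aA\to C)<:(bB\to D)$. A type is $\square$-free if $\square$ does not occur in it. Terms (modulo $\alpha$-conversion) are $$t::=x\mid c\mid ts\mid\lambda x{:}aA.t\mid\mathtt{case}_A\,t\,\mathtt{zero}\,s\,\mathtt{even}\,r\,\mathtt{odd}\,q\mid\mathtt{recursion}_A\,t\,s\,r\mid\langle t,s\rangle\mid\pi_1(t)\mid\pi_2(t),\qquad c::=n\mid S_0\mid S_1\mid P\mid\mathtt{rand}\quad(n\in\mathbb N),$$ with $\mathrm{type}(n)=\mathrm{type}(\mathtt{rand})=\mathbf N$ and $\mathrm{type}(S_0)=\mathrm{type}(S_1)=\mathrm{type}(P)=\blacksquare\mathbf N\to\mathbf N$. Contexts are finite sets of assignments $x:aA$ to distinct variables; $\Gamma,\Delta$ is the union of contexts with disjoint domains, written $\Gamma;\Delta$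 if moreover all types in $\Gamma$ are base types; $\Gamma<:a$ means $b<:a$ for all aspects $b$ in $\Gamma$. The typing rules are: * $\Gamma\vdash x:A$ if $x:aA\in\Gamma$; $\Gamma\vdash c:\mathrm{type}(c)$; from $\Gamma\vdash t:A$ and $A<:B$ infer $\Gamma\vdash t:B$; from $\Gamma,x:aA\vdash t:B$ infer $\Gamma\vdash\lambda x{:}aA.t:aA\to B$; * from $\Gamma;\Delta_1\vdash t:aA\to B$, $\Gamma;\Delta_2\vdash s:A$ and $\Gamma,\Delta_2<:a$ infer $\Gamma;\Delta_1,\Delta_2\vdash ts:B$; * from $\Gamma;\Delta_1\vdash t:\mathbf N$, $\Gamma;\Delta_2\vdash s:A$, $\Gamma;\Delta_3\vdash r:A$, $\Gamma;\Delta_4\vdash q:A$ with $A$ $\square$-free infer $\Gamma;\Delta_1,\Delta_2,\Delta_3,\Delta_4\vdash\mathtt{case}_A\,t\,\mathtt{zero}\,s\,\mathtt{even}\,r\,\mathtt{odd}\,q:A$; * from $\Gamma_1;\Delta_1\vdash t:\mathbf N$, $\Gamma_1,\Gamma_2;\Delta_2\vdash s:A$, $\Gamma_1,\Gamma_2;\vdash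 r:\square\mathbf N\to\blacksquare A\to A$, $\Gamma_1,\Delta_1<:\square$ with $A$ $\square$-free infer $\Gamma_1,\Gamma_2;\Delta_1,\Delta_2\vdash\mathtt{recursion}_A\,t\,s\,r:A$; * from $\Gamma;\Delta_1\vdash t:G$ and $\Gamma;\Delta_2\vdash s:F$ ($G,F$ base types) infer $\Gamma;\Delta_1,\Delta_2\vdash\langle t,s\rangle:G\times F$; from $\Gamma\vdash t:G\times F$ infer $\Gamma\vdash\pi_1(t):G$ and $\Gamma\vdash\pi_2(t):F$. A *first-order term of arity $k$* is a closed term of type $a_1\mathbf N\to\cdots\to a_k\mathbf N\to\mathbf N$ for some aspects $a_1,\dots,a_k$. One-step reduction relates a term to a nonempty sequence of terms. It is generated by the following axioms, closed under all contexts except the second and third argument of a recursion (a context is applied to every member of the sequence): $\mathtt{case}_A\,n\,\mathtt{zero}\,t\,\mathtt{even}\,s\,\mathtt{odd}\,r$ reduces to $t$ if $n=0$, to $s$ if $n\ge1$ is even, to $r$ if $n$ is odd; $\mathtt{recursion}_A\,0\,g\,f\to g$; $\mathtt{recursion}_A\,n\,g\,f\to f\,n\,(\mathtt{recursion}_A\,\lfloor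 n/2\rfloor\,g\,f)$ for $n\ge1$; $S_0n\to2n$; $S_1n\to2n+1$; $Pn\to\lfloor n/2\rfloor$; $(\lambda x{:}aG.t)v\to t[v/x]$ for $G$ a base type and $v$ a value (a numeral or a pair of values); $(\lambda x{:}aH.t)s\to t[s/x]$ for $H$ a function type; $(\lambda x{:}aA.t)sr\to(\lambda x{:}aA.tr)s$ ($x$ not free in $r$); $\pi_1(\langle t,s\rangle)\to t$; $\pi_2(\langle t,s\rangle)\to s$; $\mathtt{rand}\to0,1$. Evaluation $t\rightsquigarrow\mathscr D$ of terms to probability distributions on terms is defined inductively: if $t$ is in normal form, then $t\rightsquigarrow$ the distribution concentrated on $t$; if $t\to t_1,\dots,t_n$ and $t_i\rightsquigarrow\mathscr D_i$ for all $i$, then $t\rightsquigarrow\sum_{i=1}^n\frac1n\mathscr D_i$. **Machines.** A probabilistic Turing machine $M$ has a finite set of states with an initial state and a set of final states, one two-way infinite tape over a finite alphabet that contains three distinct symbols $0,1,\sqcup$, and for each state and scanned symbol two (possibly equal) actions (new state, written symbol, head move $\leftarrow,\downarrow$ or $\rightarrow$), one of which is selected at each step by a fair coin toss; it halts when it reaches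 a final state. On input $n\in\mathbb N$ the tape contains the binary representation of $n$, most significant digit first (no digit for $n=0$), and is otherwise blank, with the head on the first digit. The result of a halted computation is the number whose binary digits, most significant first, stand on the tape from the head to the right, up to the first symbol other than $0,1$. $M$ runs in polynomial time if there is a polynomial $p$ with natural coefficients such that on every input $n$ and for all outcomes of the coin tosses $M$ halts within $p(|n|)$ steps, where $|n|$ is the number of binary digits of $n$ ($|0|=0$). **Theorem.** Let $M$ be a probabilistic Turing machine running in polynomial time, and for every $n\in\mathbb N$ let $\mathscr D_n$ be the probability distribution on $\mathbb N$ of the results of $M$ on input $n$. Then there is a first-order term $t$ of arity $1$ of RSLR with pairs such that for every $n\in\mathbb N$, $t\,n\rightsquigarrow\mathscr D_n$, where $\mathscr D_n$ is regarded as a distribution on terms supported on numerals. -/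

import Mathlib

namespace RSLR

/-! ### Types and subtyping -/

/-- Base types: natural numbers and pairs of base types. -/
inductive BTy : Type
  | nat : BTy
  | prod : BTy → BTy → BTy

/-- The aspects: `modal` is `□`, `nonmodal` is `■`. -/
inductive Aspect : Type
  | modal : Aspect
  | nonmodal : Aspect

/-- The order `{(□,□), (□,■), (■,■)}` on aspects. -/
def Aspect.Le (a b : Aspect) : Prop := a = .modal ∨ b = .nonmodal

/-- Types: base types and function types `a A → B`, with `a` an aspect. -/
inductive Ty : Type
  | base : BTy → Ty
  | arr : Aspect → Ty → Ty → Ty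

/-- The type `N`. -/
abbrev Ty.nat : Ty := .base .nat

def Ty.IsBase : Ty → Prop
  | .base _ => True
  | .arr _ _ _ => False

/-- No occurrence of `□` in the type. -/
def Ty.BoxFree : Ty → Prop
  | .base _ => True
  | .arr a A B => a = .nonmodal ∧ A.BoxFree ∧ B.BoxFree

inductive Sub : Ty → Ty → Prop
  | refl (A : Ty) : Sub A A
  | trans {A B C : Ty} : Sub A B → Sub B C → Sub A C
  | arr {a b : Aspect} {A B C D : Ty} :
      Sub B A → Sub C D → b.Le a → Sub (.arr a A C) (.arr b B D)

/-! ### Terms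

Terms modulo renaming of bound variables, as de Bruijn terms: `var 0` is the variable bound by
the innermost enclosing abstraction. -/

inductive Cst : Type
  | num : ℕ → Cst
  | S0 : Cst
  | S1 : Cst
  | P : Cst
  | rand : Cst

/-- The type of a constant. -/
def Cst.ty : Cst → Ty
  | .num _ => .nat
  | .S0 => .arr .nonmodal .nat .nat
  | .S1 => .arr .nonmodal .nat .nat
  | .P => .arr .nonmodal .nat .nat
  | .rand => .nat

inductive Tm : Type
  | var : ℕ → Tm
  | cst : Cst → Tm
  | app : Tm → Tm → Tm
  /-- `lam a A t` is `λ x : a A. t`. -/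
  | lam : Aspect → Ty → Tm → Tm
  /-- `caseOf A t s r q` is `case_A t zero s even r odd q`. -/
  | caseOf : Ty → Tm → Tm → Tm → Tm → Tm
  /-- `recursion A t s r` is `recursion_A t s r`: argument `t`, base value `s`, step `r`. -/
  | recursion : Ty → Tm → Tm → Tm → Tm
  | pair : Tm → Tm → Tm
  | fst : Tm → Tm
  | snd : Tm → Tm

namespace Tm

/-- The numeral `n`. -/
abbrev num (n : ℕ) : Tm := .cst (.num n)

/-- Extend a renaming under a binder. -/
def upRen (ρ : ℕ → ℕ) : ℕ → ℕ
  | 0 => 0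
  | i + 1 => ρ i + 1

def rename : Tm → (ℕ → ℕ) → Tm
  | var i, ρ => var (ρ i)
  | cst c, _ => cst c
  | app t s, ρ => app (t.rename ρ) (s.rename ρ)
  | lam a A t, ρ => lam a A (t.rename (upRen ρ))
  | caseOf A t s r q, ρ => caseOf A (t.rename ρ) (s.rename ρ) (r.rename ρ) (q.rename ρ)
  | recursion A t s r, ρ => recursion A (t.rename ρ) (s.rename ρ) (r.rename ρ)
  | pair t s, ρ => pair (t.rename ρ) (s.rename ρ)
  | fst t, ρ => fst (t.rename ρ)
  | snd t, ρ => snd (t.rename ρ)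

/-- Extend a simultaneous substitution under a binder. -/
def upSubst (σ : ℕ → Tm) : ℕ → Tm
  | 0 => var 0
  | i + 1 => (σ i).rename Nat.succ

/-- Simultaneous capture-avoiding substitution. -/
def subst : Tm → (ℕ → Tm) → Tm
  | var i, σ => σ i
  | cst c, _ => cst c
  | app t s, σ => app (t.subst σ) (s.subst σ)
  | lam a A t, σ => lam a A (t.subst (upSubst σ))
  | caseOf A t s r q, σ => caseOf A (t.subst σ) (s.subst σ) (r.subst σ) (q.subst σ)
  | recursion A t s r, σ => recursion A (t.subst σ) (s.subst σ) (r.subst σ)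
  | pair t s, σ => pair (t.subst σ) (s.subst σ)
  | fst t, σ => fst (t.subst σ)
  | snd t, σ => snd (t.subst σ)

/-- The substitution that sends the innermost variable to `s` and fixes the others. -/
def single (s : Tm) : ℕ → Tm
  | 0 => s
  | i + 1 => var i

/-- `t.inst s` is `t[s/x]`, for `x` the innermost variable of `t`. -/
def inst (t s : Tm) : Tm := t.subst (single s)

end Tm

/-! ### Reduction -/

/-- The values of base type: numerals and pairs of values. -/
inductive Value : Tm → Prop
  | num (n : ℕ) : Value (.num n)
  | pair {t s : Tm} : Value t → Value s → Value (.pair t s)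

open Tm in
/-- One-step reduction `t → t₀, …, tₙ` between terms and nonempty sequences of terms: the axioms,
closed under every context except the second and third argument of a recursion. -/
inductive Red : Tm → {n : ℕ} → (Fin (n + 1) → Tm) → Prop
  | caseZero (A : Ty) (t s r : Tm) : Red (caseOf A (num 0) t s r) ![t]
  | caseEven (A : Ty) (n : ℕ) (t s r : Tm) :
      n ≠ 0 → Red (caseOf A (num (2 * n)) t s r) ![s]
  | caseOdd (A : Ty) (n : ℕ) (t s r : Tm) : Red (caseOf A (num (2 * n + 1)) t s r) ![r]
  | recZero (A : Ty) (g f : Tm) : Red (recursion A (num 0) g f) ![g]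
  | recStep (A : Ty) (n : ℕ) (g f : Tm) : n ≠ 0 →
      Red (recursion A (num n) g f) ![app (app f (num n)) (recursion A (num (n / 2)) g f)]
  | S0 (n : ℕ) : Red (app (cst .S0) (num n)) ![num (2 * n)]
  | S1 (n : ℕ) : Red (app (cst .S1) (num n)) ![num (2 * n + 1)]
  | P (n : ℕ) : Red (app (cst .P) (num n)) ![num (n / 2)]
  | betaBase (a : Aspect) (G : BTy) (t v : Tm) :
      Value v → Red (app (lam a (.base G) t) v) ![t.inst v]
  | betaArr (a b : Aspect) (A B : Ty) (t s : Tm) :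
      Red (app (lam a (.arr b A B) t) s) ![t.inst s]
  | swap (a : Aspect) (A : Ty) (t s r : Tm) :
      Red (app (app (lam a A t) s) r) ![app (lam a A (app t (r.rename Nat.succ))) s]
  | rand : Red (cst .rand) ![num 0, num 1]
  | fstPair (t s : Tm) : Red (fst (pair t s)) ![t]
  | sndPair (t s : Tm) : Red (snd (pair t s)) ![s]
  | appL {t : Tm} {n : ℕ} {ts : Fin (n + 1) → Tm} (s : Tm) :
      Red t ts → Red (app t s) fun i => app (ts i) s
  | appR {t : Tm} {n : ℕ} {ts : Fin (n + 1) → Tm} (s : Tm) :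
      Red t ts → Red (app s t) fun i => app s (ts i)
  | lam {t : Tm} {n : ℕ} {ts : Fin (n + 1) → Tm} (a : Aspect) (A : Ty) :
      Red t ts → Red (lam a A t) fun i => lam a A (ts i)
  | case1 {t : Tm} {n : ℕ} {ts : Fin (n + 1) → Tm} (A : Ty) (s r q : Tm) :
      Red t ts → Red (caseOf A t s r q) fun i => caseOf A (ts i) s r q
  | case2 {t : Tm} {n : ℕ} {ts : Fin (n + 1) → Tm} (A : Ty) (s r q : Tm) :
      Red t ts → Red (caseOf A s t r q) fun i => caseOf A s (ts i) r q
  | case3 {t : Tm} {n : ℕ} {ts : Fin (n + 1) → Tm} (A : Ty) (s r q : Tm) :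
      Red t ts → Red (caseOf A s r t q) fun i => caseOf A s r (ts i) q
  | case4 {t : Tm} {n : ℕ} {ts : Fin (n + 1) → Tm} (A : Ty) (s r q : Tm) :
      Red t ts → Red (caseOf A s r q t) fun i => caseOf A s r q (ts i)
  | recArg {t : Tm} {n : ℕ} {ts : Fin (n + 1) → Tm} (A : Ty) (g f : Tm) :
      Red t ts → Red (recursion A t g f) fun i => recursion A (ts i) g f
  | pairL {t : Tm} {n : ℕ} {ts : Fin (n + 1) → Tm} (s : Tm) :
      Red t ts → Red (pair t s) fun i => pair (ts i) s
  | pairR {t : Tm} {n : ℕ} {ts : Fin (n + 1) → Tm} (s : Tm) :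
      Red t ts → Red (pair s t) fun i => pair s (ts i)
  | fst {t : Tm} {n : ℕ} {ts : Fin (n + 1) → Tm} :
      Red t ts → Red (fst t) fun i => fst (ts i)
  | snd {t : Tm} {n : ℕ} {ts : Fin (n + 1) → Tm} :
      Red t ts → Red (snd t) fun i => snd (ts i)

/-- `t` is in normal form. -/
def NF (t : Tm) : Prop := ∀ (n : ℕ) (ts : Fin (n + 1) → Tm), ¬ Red t ts

/-- Multistep reduction `t ⇝ 𝒟` of terms to probability distributions on terms: either `t` is in
normal form and `𝒟` is concentrated on `t`, or `t → t₀, …, tₙ`, `tᵢ ⇝ 𝒟ᵢ` and `𝒟` is the mean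
of the `𝒟ᵢ`. -/
inductive Eval : Tm → PMF Tm → Prop
  | nf {t : Tm} : NF t → Eval t (PMF.pure t)
  | step {t : Tm} {n : ℕ} {ts : Fin (n + 1) → Tm} {D : Fin (n + 1) → PMF Tm} :
      Red t ts → (∀ i, Eval (ts i) (D i)) →
      Eval t ((PMF.uniformOfFintype (Fin (n + 1))).bind D)

/-! ### Typing -/

/-- Contexts: partial maps from (de Bruijn indices of) variables to aspects and types. All contexts
in a derivation whose conclusion has the empty context have finite domain. -/
abbrev Ctx : Type := ℕ → Option (Aspect × Ty)

namespace Ctx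

def empty : Ctx := fun _ => none

/-- `Γ, x : a A`, for `x` the innermost variable. -/
def cons (a : Aspect) (A : Ty) (Γ : Ctx) : Ctx
  | 0 => some (a, A)
  | i + 1 => Γ i

/-- `Γ` and `Δ` have disjoint domains. -/
def Disj (Γ Δ : Ctx) : Prop := ∀ i, Γ i = none ∨ Δ i = none

/-- The union `Γ, Δ` (used for disjoint contexts only). -/
def union (Γ Δ : Ctx) : Ctx := fun i => (Γ i).or (Δ i)

/-- All types in `Γ` are base types. -/
def Base (Γ : Ctx) : Prop := ∀ i a A, Γ i = some (a, A) → A.IsBase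

/-- `Γ <: a`: every aspect `b` in `Γ` satisfies `b <: a`. -/
def Le (Γ : Ctx) (a : Aspect) : Prop := ∀ i b A, Γ i = some (b, A) → b.Le a

end Ctx

open Tm in
/-- `Typed Γ t A` is `Γ ⊢ t : A`. The contexts named `Γ` below are shared by the premises and hold
base types only; the contexts named `Δ` are split between the premises. -/
inductive Typed : Ctx → Tm → Ty → Prop
  | var {Γ : Ctx} {i : ℕ} {a : Aspect} {A : Ty} : Γ i = some (a, A) → Typed Γ (var i) A
  | sub {Γ : Ctx} {t : Tm} {A B : Ty} : Typed Γ t A → Sub A B → Typed Γ t B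
  | lam {Γ : Ctx} {t : Tm} {a : Aspect} {A B : Ty} :
      Typed (Γ.cons a A) t B → Typed Γ (lam a A t) (.arr a A B)
  | cst {Γ : Ctx} (c : Cst) : Typed Γ (cst c) c.ty
  | caseOf {Γ Δ₁ Δ₂ Δ₃ Δ₄ : Ctx} {t s r q : Tm} {A : Ty} :
      [Γ, Δ₁, Δ₂, Δ₃, Δ₄].Pairwise Ctx.Disj → Γ.Base →
      Typed (Γ.union Δ₁) t .nat → Typed (Γ.union Δ₂) s A →
      Typed (Γ.union Δ₃) r A → Typed (Γ.union Δ₄) q A → A.BoxFree →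
      Typed (Γ.union (Δ₁.union (Δ₂.union (Δ₃.union Δ₄)))) (caseOf A t s r q) A
  | recursion {Γ₁ Γ₂ Δ₁ Δ₂ : Ctx} {t s r : Tm} {A : Ty} :
      [Γ₁, Γ₂, Δ₁, Δ₂].Pairwise Ctx.Disj → Γ₁.Base → Γ₂.Base →
      Typed (Γ₁.union Δ₁) t .nat → Typed ((Γ₁.union Γ₂).union Δ₂) s A →
      Typed (Γ₁.union Γ₂) r (.arr .modal .nat (.arr .nonmodal A A)) →
      (Γ₁.union Δ₁).Le .modal → A.BoxFree →
      Typed ((Γ₁.union Γ₂).union (Δ₁.union Δ₂)) (recursion A t s r) A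
  | app {Γ Δ₁ Δ₂ : Ctx} {t s : Tm} {a : Aspect} {A B : Ty} :
      [Γ, Δ₁, Δ₂].Pairwise Ctx.Disj → Γ.Base →
      Typed (Γ.union Δ₁) t (.arr a A B) → Typed (Γ.union Δ₂) s A → (Γ.union Δ₂).Le a →
      Typed (Γ.union (Δ₁.union Δ₂)) (app t s) B
  | pair {Γ Δ₁ Δ₂ : Ctx} {t s : Tm} {G F : BTy} :
      [Γ, Δ₁, Δ₂].Pairwise Ctx.Disj → Γ.Base →
      Typed (Γ.union Δ₁) t (.base G) → Typed (Γ.union Δ₂) s (.base F) →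
      Typed (Γ.union (Δ₁.union Δ₂)) (pair t s) (.base (.prod G F))
  | fst {Γ : Ctx} {t : Tm} {G F : BTy} :
      Typed Γ t (.base (.prod G F)) → Typed Γ (fst t) (.base G)
  | snd {Γ : Ctx} {t : Tm} {G F : BTy} :
      Typed Γ t (.base (.prod G F)) → Typed Γ (snd t) (.base F)

/-- The type `a₁ N → a₂ N → ⋯ → aₖ N → N`. -/
def firstOrderTy : List Aspect → Ty
  | [] => .nat
  | a :: as => .arr a .nat (firstOrderTy as)

/-- First-order terms of arity `k`: closed terms of type `a₁ N → ⋯ → aₖ N → N` for some aspects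
`a₁, …, aₖ`. -/
def IsFirstOrder (k : ℕ) (t : Tm) : Prop :=
  ∃ as : List Aspect, as.length = k ∧ Typed Ctx.empty t (firstOrderTy as)

end RSLR

/-! ### Probabilistic Turing machines -/

namespace PTM

/-- Head moves `←`, `↓`, `→`. -/
inductive Move : Type
  | left : Move
  | stay : Move
  | right : Move

/-- One-tape probabilistic Turing machines with states `Q` and tape alphabet `S`. For each state and
symbol, `trans` gives the two possible actions, one for each outcome of a coin toss. The alphabet
contains the blank and two further symbols, the binary digits `0` (`digit false`) and `1`
(`digit true`). -/
structure Machine (Q S : Type*) where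
  start : Q
  final : Set Q
  blank : S
  digit : Bool → S
  digit_injective : Function.Injective digit
  digit_ne_blank : ∀ b, digit b ≠ blank
  trans : Q → S → Bool → Q × S × Move

/-- Configurations: the state, the scanned symbol, and the parts of the tape to the left and to the
right of the head, both listed from the head outwards. All cells beyond the two lists are blank. -/
structure Cfg (Q S : Type*) where
  state : Q
  left : List S
  head : S
  right : List S

namespace Machine

variable {Q S : Type*}

/-- The configuration after a step, if the coin shows `b`. -/
def next (M : Machine Q S) (c : Cfg Q S) (b : Bool) : Cfg Q S :=
  match M.trans c.state c.head b with
  | (q, s, .left) => ⟨q, c.left.tail, c.left.headD M.blank, s :: c.right⟩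
  | (q, s, .stay) => ⟨q, c.left, s, c.right⟩
  | (q, s, .right) => ⟨q, s :: c.left, c.right.headD M.blank, c.right.tail⟩

open Classical in
/-- One step with a fair coin; configurations in a final state do not change any more. -/
noncomputable def stepDist (M : Machine Q S) (c : Cfg Q S) : PMF (Cfg Q S) :=
  if c.state ∈ M.final then PMF.pure c else (PMF.uniformOfFintype Bool).map (M.next c)

/-- The input `n`: its binary digits, most significant first (no digits for `n = 0`). -/
def input (M : Machine Q S) (n : ℕ) : List S := n.bits.reverse.map M.digit

/-- The initial configuration on input `n`: the head is on the first digit, the rest of the tape is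
blank. -/
def initial (M : Machine Q S) (n : ℕ) : Cfg Q S :=
  ⟨M.start, [], (M.input n).headD M.blank, (M.input n).tail⟩

/-- The distribution of configurations after `T` steps on input `n`. -/
noncomputable def run (M : Machine Q S) (n : ℕ) : ℕ → PMF (Cfg Q S)
  | 0 => PMF.pure (M.initial n)
  | T + 1 => (M.run n T).bind M.stepDist

open Classical in
/-- Read binary digits, most significant first, up to the first symbol that is not a digit, starting
from the value `k` of the digits read so far. -/
noncomputable def readFrom (M : Machine Q S) (k : ℕ) : List S → ℕ
  | [] => k
  | s :: l =>
      if s = M.digit false then M.readFrom (2 * k) l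
      else if s = M.digit true then M.readFrom (2 * k + 1) l
      else k

/-- The result of a halted configuration: the number whose binary digits stand on the tape from the
head to the right, up to the first symbol that is not a digit. -/
noncomputable def result (M : Machine Q S) (c : Cfg Q S) : ℕ := M.readFrom 0 (c.head :: c.right)

/-- On input `n`, every computation has halted after at most `T` steps, whatever the coins show. -/
def HaltsWithin (M : Machine Q S) (n T : ℕ) : Prop := ∀ c ∈ (M.run n T).support, c.state ∈ M.final

/-- The number of steps is bounded by a polynomial in the length of the binary representation of the
input, on all inputs and for all outcomes of the coin tosses. -/
def IsPolyTime (M : Machine Q S) : Prop :=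
  ∃ p : Polynomial ℕ, ∀ n : ℕ, M.HaltsWithin n (p.eval n.size)

open Classical in
/-- The distribution of the results of `M` on an input `n` on which `M` halts within a bounded number
of steps. -/
noncomputable def resultDist (M : Machine Q S) (n : ℕ) (h : ∃ T, M.HaltsWithin n T) : PMF ℕ :=
  (M.run n (Nat.find h)).map M.result

theorem IsPolyTime.halts {M : Machine Q S} (h : M.IsPolyTime) (n : ℕ) :
    ∃ T, M.HaltsWithin n T := by
  obtain ⟨p, hp⟩ := h
  exact ⟨_, hp n⟩

end Machine

end PTM

namespace RSLR

open Tm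

/-! ### Typing: weakening, closed terms, and rules for shared contexts -/

/-! A recursion may have a function type as its result, provided that this type is □-free. Let C be
the base type of configurations. Terms of type ■C → C are computations, and their composition is
iteration. `loopTm` recurses on n at this type, with a step that sends g to λc. g (F n x c). The
recursive value g is used once, as the linearity of function types demands, while n is □ and of base
type and may be used again inside the body. The loop makes |n| rounds. Nesting gives powers: if a
term makes (|n| + 2)^k steps, its use once in every round and twice at the end makes |n|(|n| + 2)^k
+ 2(|n| + 2)^k = (|n| + 2)^(k + 1) steps (`ev_stepsTm`). Every polynomial in |n| lies below such a
power (`Polynomial.exists_eval_le_pow`), and surplus steps are harmless because halted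
configurations no longer change (`run_add_of_haltsWithin`).

A configuration is a value: the state, the scanned symbol and the two halves of the tape, which are
stacks coded as numbers with one block of bits per symbol. The blank has code 0, so the number 0 is
an endless blank tape. P, S₀ and S₁ pop and push blocks, nested cases read them, and one machine
step is a finite case distinction followed by a case on rand (`ev_stepBody`). Input and output are
loops too. The output loop runs on the number of the final tape and needs it as a □ argument; this
is allowed because the only free variable of that argument, n, is □.

Probabilities are tracked by `Ev`. The leaves of its trees need not be normal, so trees can be put
into contexts and grafted (`Ev.bind`), in step with the bind of distributions. Normal forms matter
only at the end (`Ev.eval`). Arguments of base type are evaluated before they are substituted, so a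
coin is tossed once even if its outcome is used repeatedly. -/

theorem Ctx.union_of_none_right {Γ Δ : Ctx} {i : ℕ} (h : Δ i = none) : Γ.union Δ i = Γ i := by
  simp [Ctx.union, h]

theorem Ctx.union_empty (Γ : Ctx) : Γ.union Ctx.empty = Γ :=
  funext fun _ => Ctx.union_of_none_right rfl

theorem Ctx.disj_empty (Γ : Ctx) : Γ.Disj Ctx.empty := fun _ => Or.inr rfl

/-- `Γ'` extends `Γ`. -/
def Ctx.Sub (Γ Γ' : Ctx) : Prop := ∀ i, Γ i = none ∨ Γ' i = Γ i

theorem Ctx.Sub.cons {Γ Γ' : Ctx} (h : Γ.Sub Γ') (a : Aspect) (A : Ty) :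
    (Γ.cons a A).Sub (Γ'.cons a A) := by
  rintro (_ | i)
  · exact Or.inr rfl
  · exact h i

theorem Ctx.empty_sub (Γ : Ctx) : Ctx.empty.Sub Γ := fun _ => Or.inl rfl

/-- The part of `Γ'` outside the domain of `Γ`. -/
def Ctx.diff (Γ' Γ : Ctx) : Ctx := fun i => if Γ i = none then Γ' i else none

/-- The rules split the context exactly, so one premise has to receive the new assignments. It is
the first one, except in a recursion: there the argument admits modal variables only, and the base
value takes them. In an application they go to the function, since the aspect bounds the context of
the argument. -/
theorem Typed.weaken {Γ : Ctx} {t : Tm} {A : Ty} (h : Typed Γ t A) :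
    ∀ {Γ' : Ctx}, Γ.Sub Γ' → Typed Γ' t A := by
  induction h with
  | var h =>
    intro Γ' hs
    rename_i Γ i a A
    refine .var (a := a) ?_
    rcases hs i with h' | h'
    · simp [h] at h'
    · rw [h', h]
  | sub _ hs ih => intro Γ' h; exact .sub (ih h) hs
  | lam _ ih => intro Γ' h; exact .lam (ih (h.cons _ _))
  | cst c => intro Γ' h; exact .cst c
  | @caseOf Γ Δ₁ Δ₂ Δ₃ Δ₄ t s r q A hd hb _ _ _ _ hA ih₁ ih₂ ih₃ ih₄ =>
    intro Γ' hs
    set U := Γ.union (Δ₁.union (Δ₂.union (Δ₃.union Δ₄))) with hU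
    have hU' : ∀ i, U i = (Γ i).or ((Δ₁ i).or ((Δ₂ i).or ((Δ₃ i).or (Δ₄ i)))) := fun i => rfl
    have e : Γ' = Γ.union ((Δ₁.union (Γ'.diff U)).union (Δ₂.union (Δ₃.union Δ₄))) := by
      funext i
      have := hU' i
      rcases hs i with h | h
      · simp_all [Ctx.union, Ctx.diff]
      · by_cases h0 : U i = none <;> simp_all [Ctx.union, Ctx.diff]
    rw [e]
    simp only [List.pairwise_cons, List.mem_cons, List.not_mem_nil, or_false, forall_eq_or_imp,
      forall_eq] at hd
    have hU'' : ∀ i, U i = none → Γ i = none ∧ Δ₁ i = none ∧ Δ₂ i = none ∧ Δ₃ i = none ∧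
        Δ₄ i = none := fun i h => by simpa [hU' i] using h
    have hD : ∀ X : Ctx, (∀ i, U i = none → X i = none) → ∀ i, X i = none ∨ Γ'.diff U i = none := by
      intro X hX i
      by_cases h : U i = none
      · exact Or.inl (hX i h)
      · right; simp [Ctx.diff, h]
    have d0 := hD Γ fun i h => (hU'' i h).1
    have d2 := hD Δ₂ fun i h => (hU'' i h).2.2.1
    have d3 := hD Δ₃ fun i h => (hU'' i h).2.2.2.1
    have d4 := hD Δ₄ fun i h => (hU'' i h).2.2.2.2
    obtain ⟨⟨a1, a2, a3, a4⟩, ⟨b2, b3, b4⟩, ⟨c3, c4⟩, c5, _⟩ := hd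
    refine .caseOf ?_ hb (ih₁ ?_) ‹_› ‹_› ‹_› hA
    · simp only [List.pairwise_cons, List.mem_cons, List.not_mem_nil, or_false, forall_eq_or_imp,
        forall_eq]
      refine ⟨⟨fun i => ?_, a2, a3, a4⟩, ⟨fun i => ?_, fun i => ?_, fun i => ?_⟩, ⟨c3, c4⟩, c5,
        by simp⟩
      · have := a1 i; have := d0 i; simp only [Ctx.union, Option.or_eq_none_iff]; tauto
      · have := b2 i; have := d2 i; simp only [Ctx.union, Option.or_eq_none_iff]; tauto
      · have := b3 i; have := d3 i; simp only [Ctx.union, Option.or_eq_none_iff]; tauto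
      · have := b4 i; have := d4 i; simp only [Ctx.union, Option.or_eq_none_iff]; tauto
    · intro i
      rcases h0 : Γ i with _ | x <;> rcases h1 : Δ₁ i with _ | y <;> simp [Ctx.union, h0, h1]
  | @recursion Γ₁ Γ₂ Δ₁ Δ₂ t s r A hd hb₁ hb₂ _ _ _ hm hA ih₁ ih₂ ih₃ =>
    intro Γ' hs
    set U := (Γ₁.union Γ₂).union (Δ₁.union Δ₂) with hU
    have hU' : ∀ i, U i = ((Γ₁ i).or (Γ₂ i)).or ((Δ₁ i).or (Δ₂ i)) := fun i => rfl
    have e : Γ' = (Γ₁.union Γ₂).union (Δ₁.union (Δ₂.union (Γ'.diff U))) := by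
      funext i
      have := hU' i
      rcases hs i with h | h
      · simp_all [Ctx.union, Ctx.diff]
      · by_cases h0 : U i = none <;> simp_all [Ctx.union, Ctx.diff]
    rw [e]
    simp only [List.pairwise_cons, List.mem_cons, List.not_mem_nil, or_false, forall_eq_or_imp,
      forall_eq] at hd
    have hU'' : ∀ i, U i = none → (Γ₁ i = none ∧ Γ₂ i = none) ∧ Δ₁ i = none ∧ Δ₂ i = none :=
      fun i h => by simpa [hU' i] using h
    have hD : ∀ X : Ctx, (∀ i, U i = none → X i = none) → ∀ i, X i = none ∨ Γ'.diff U i = none := by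
      intro X hX i
      by_cases h : U i = none
      · exact Or.inl (hX i h)
      · right; simp [Ctx.diff, h]
    have d1 := hD Γ₁ fun i h => (hU'' i h).1.1
    have d2 := hD Γ₂ fun i h => (hU'' i h).1.2
    have d3 := hD Δ₁ fun i h => (hU'' i h).2.1
    obtain ⟨⟨a1, a2, a3⟩, ⟨b2, b3⟩, c3, _⟩ := hd
    refine .recursion ?_ hb₁ hb₂ ‹_› (ih₂ ?_) ‹_› hm hA
    · simp only [List.pairwise_cons, List.mem_cons, List.not_mem_nil, or_false, forall_eq_or_imp,
        forall_eq]
      refine ⟨⟨a1, a2, fun i => ?_⟩, ⟨b2, fun i => ?_⟩, fun i => ?_, by simp⟩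
      · have := a3 i; have := d1 i; simp only [Ctx.union, Option.or_eq_none_iff]; tauto
      · have := b3 i; have := d2 i; simp only [Ctx.union, Option.or_eq_none_iff]; tauto
      · have := c3 i; have := d3 i; simp only [Ctx.union, Option.or_eq_none_iff]; tauto
    · intro i
      rcases h0 : Γ₁ i with _ | x <;> rcases h1 : Γ₂ i with _ | y <;>
        rcases h2 : Δ₂ i with _ | z <;> simp [Ctx.union, h0, h1, h2]
  | @app Γ Δ₁ Δ₂ t s a A B hd hb _ _ hl ih₁ ih₂ =>
    intro Γ' hs
    set U := Γ.union (Δ₁.union Δ₂) with hU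
    have hU' : ∀ i, U i = (Γ i).or ((Δ₁ i).or (Δ₂ i)) := fun i => rfl
    have e : Γ' = Γ.union ((Δ₁.union (Γ'.diff U)).union Δ₂) := by
      funext i
      have := hU' i
      rcases hs i with h | h
      · simp_all [Ctx.union, Ctx.diff]
      · by_cases h0 : U i = none <;> simp_all [Ctx.union, Ctx.diff]
    rw [e]
    simp only [List.pairwise_cons, List.mem_cons, List.not_mem_nil, or_false, forall_eq_or_imp,
      forall_eq] at hd
    have hU'' : ∀ i, U i = none → Γ i = none ∧ Δ₁ i = none ∧ Δ₂ i = none :=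
      fun i h => by simpa [hU' i] using h
    have hD : ∀ X : Ctx, (∀ i, U i = none → X i = none) → ∀ i, X i = none ∨ Γ'.diff U i = none := by
      intro X hX i
      by_cases h : U i = none
      · exact Or.inl (hX i h)
      · right; simp [Ctx.diff, h]
    have d0 := hD Γ fun i h => (hU'' i h).1
    have d2 := hD Δ₂ fun i h => (hU'' i h).2.2
    obtain ⟨⟨a1, a2⟩, b2, _⟩ := hd
    refine .app ?_ hb (ih₁ ?_) ‹_› hl
    · simp only [List.pairwise_cons, List.mem_cons, List.not_mem_nil, or_false, forall_eq_or_imp,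
        forall_eq]
      refine ⟨⟨fun i => ?_, a2⟩, fun i => ?_, by simp⟩
      · have := a1 i; have := d0 i; simp only [Ctx.union, Option.or_eq_none_iff]; tauto
      · have := b2 i; have := d2 i; simp only [Ctx.union, Option.or_eq_none_iff]; tauto
    · intro i
      rcases h0 : Γ i with _ | x <;> rcases h1 : Δ₁ i with _ | y <;> simp [Ctx.union, h0, h1]
  | @pair Γ Δ₁ Δ₂ t s G F hd hb _ _ ih₁ ih₂ =>
    intro Γ' hs
    set U := Γ.union (Δ₁.union Δ₂) with hU
    have hU' : ∀ i, U i = (Γ i).or ((Δ₁ i).or (Δ₂ i)) := fun i => rfl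
    have e : Γ' = Γ.union ((Δ₁.union (Γ'.diff U)).union Δ₂) := by
      funext i
      have := hU' i
      rcases hs i with h | h
      · simp_all [Ctx.union, Ctx.diff]
      · by_cases h0 : U i = none <;> simp_all [Ctx.union, Ctx.diff]
    rw [e]
    simp only [List.pairwise_cons, List.mem_cons, List.not_mem_nil, or_false, forall_eq_or_imp,
      forall_eq] at hd
    have hU'' : ∀ i, U i = none → Γ i = none ∧ Δ₁ i = none ∧ Δ₂ i = none :=
      fun i h => by simpa [hU' i] using h
    have hD : ∀ X : Ctx, (∀ i, U i = none → X i = none) → ∀ i, X i = none ∨ Γ'.diff U i = none := by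
      intro X hX i
      by_cases h : U i = none
      · exact Or.inl (hX i h)
      · right; simp [Ctx.diff, h]
    have d0 := hD Γ fun i h => (hU'' i h).1
    have d2 := hD Δ₂ fun i h => (hU'' i h).2.2
    obtain ⟨⟨a1, a2⟩, b2, _⟩ := hd
    refine .pair ?_ hb (ih₁ ?_) ‹_›
    · simp only [List.pairwise_cons, List.mem_cons, List.not_mem_nil, or_false, forall_eq_or_imp,
        forall_eq]
      refine ⟨⟨fun i => ?_, a2⟩, fun i => ?_, by simp⟩
      · have := a1 i; have := d0 i; simp only [Ctx.union, Option.or_eq_none_iff]; tauto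
      · have := b2 i; have := d2 i; simp only [Ctx.union, Option.or_eq_none_iff]; tauto
    · intro i
      rcases h0 : Γ i with _ | x <;> rcases h1 : Δ₁ i with _ | y <;> simp [Ctx.union, h0, h1]
  | fst _ ih => intro Γ' h; exact .fst (ih h)
  | snd _ ih => intro Γ' h; exact .snd (ih h)

/-- A closed term can be used in every context. -/
theorem Typed.closed {t : Tm} {A : Ty} (h : Typed Ctx.empty t A) (Γ : Ctx) : Typed Γ t A :=
  h.weaken Γ.empty_sub

/-- The domain of the context contains the free variables. For the empty context this gives
closedness, by which closed subterms pass unchanged through all later substitutions. -/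
theorem Typed.subst_eq {Γ : Ctx} {t : Tm} {A : Ty} (h : Typed Γ t A) :
    ∀ {σ : ℕ → Tm}, (∀ i, Γ i ≠ none → σ i = .var i) → t.subst σ = t := by
  induction h with
  | var h => intro σ hσ; exact hσ _ (by simp [h])
  | sub _ _ ih => exact ih
  | lam _ ih =>
    intro σ hσ
    rw [Tm.subst, ih]
    rintro (_ | i) hi
    · rfl
    · simp [Tm.upSubst, hσ i hi, Tm.rename]
  | cst c => intro σ _; rfl
  | caseOf _ _ _ _ _ _ _ ih₁ ih₂ ih₃ ih₄ =>
    intro σ hσ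
    rw [Tm.subst, ih₁, ih₂, ih₃, ih₄] <;> intro i hi <;> apply hσ <;>
      simp only [Ctx.union, ne_eq, Option.or_eq_none_iff] at hi ⊢ <;> tauto
  | recursion _ _ _ _ _ _ _ _ ih₁ ih₂ ih₃ =>
    intro σ hσ
    rw [Tm.subst, ih₁, ih₂, ih₃] <;> intro i hi <;> apply hσ <;>
      simp only [Ctx.union, ne_eq, Option.or_eq_none_iff] at hi ⊢ <;> tauto
  | app _ _ _ _ _ ih₁ ih₂ =>
    intro σ hσ
    rw [Tm.subst, ih₁, ih₂] <;> intro i hi <;> apply hσ <;>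
      simp only [Ctx.union, ne_eq, Option.or_eq_none_iff] at hi ⊢ <;> tauto
  | pair _ _ _ _ ih₁ ih₂ =>
    intro σ hσ
    rw [Tm.subst, ih₁, ih₂] <;> intro i hi <;> apply hσ <;>
      simp only [Ctx.union, ne_eq, Option.or_eq_none_iff] at hi ⊢ <;> tauto
  | fst _ ih => intro σ hσ; rw [Tm.subst, ih hσ]
  | snd _ ih => intro σ hσ; rw [Tm.subst, ih hσ]

/-- `t` has no free variables. -/
def Tm.Closed (t : Tm) : Prop := ∀ σ, t.subst σ = t

theorem Typed.isClosed {t : Tm} {A : Ty} (h : Typed Ctx.empty t A) : t.Closed :=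
  fun _ => h.subst_eq fun _ hi => absurd rfl hi

theorem Tm.rename_eq_subst (t : Tm) : ∀ ρ : ℕ → ℕ, t.rename ρ = t.subst fun i => .var (ρ i) := by
  induction t with
  | lam a A t ih =>
    intro ρ
    rw [Tm.rename, Tm.subst, ih]
    congr 2
    funext i
    cases i <;> rfl
  | _ => intro ρ; simp_all [Tm.rename, Tm.subst]

theorem Tm.Closed.rename {t : Tm} (h : t.Closed) (ρ : ℕ → ℕ) : t.rename ρ = t := by
  rw [Tm.rename_eq_subst, h]

theorem Value.closed {v : Tm} (h : Value v) : v.Closed := by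
  induction h with
  | num n => intro σ; rfl
  | pair _ _ ih₁ ih₂ => intro σ; rw [Tm.subst, ih₁, ih₂]

theorem Ctx.base_empty : Ctx.empty.Base := fun _ _ _ h => by cases h

theorem Ctx.Base.cons {Γ : Ctx} (h : Γ.Base) (a : Aspect) (G : BTy) :
    (Γ.cons a (.base G)).Base := by
  rintro (_ | i) b A hi
  · cases hi; trivial
  · exact h i b A hi

theorem Ctx.le_nonmodal (Γ : Ctx) : Γ.Le .nonmodal := fun _ _ _ _ => Or.inr rfl

theorem Ctx.le_empty (a : Aspect) : Ctx.empty.Le a := fun _ _ _ h => by cases h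

theorem Ctx.Le.cons_modal {Γ : Ctx} {a : Aspect} (h : Γ.Le a) (A : Ty) :
    (Γ.cons .modal A).Le a := by
  rintro (_ | i) b B hi
  · cases hi; exact Or.inl rfl
  · exact h i b B hi

/-- A context of base types can be shared as a whole, with empty parts left to split. The same holds
for the next three rules. -/
theorem Typed.app_shared {Γ : Ctx} {t s : Tm} {a : Aspect} {A B : Ty} (hΓ : Γ.Base) (ha : Γ.Le a)
    (ht : Typed Γ t (.arr a A B)) (hs : Typed Γ s A) : Typed Γ (.app t s) B := by
  have := Typed.app (Γ := Γ) (Δ₁ := .empty) (Δ₂ := .empty) (t := t) (s := s) (a := a) (A := A)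
    (B := B) (by simp [Ctx.disj_empty]) hΓ
  simp only [Ctx.union_empty] at this
  exact this ht hs ha

theorem Typed.pair_shared {Γ : Ctx} {t s : Tm} {G F : BTy} (hΓ : Γ.Base)
    (ht : Typed Γ t (.base G)) (hs : Typed Γ s (.base F)) :
    Typed Γ (.pair t s) (.base (.prod G F)) := by
  have := Typed.pair (Γ := Γ) (Δ₁ := .empty) (Δ₂ := .empty) (t := t) (s := s) (G := G) (F := F)
    (by simp [Ctx.disj_empty]) hΓ
  simp only [Ctx.union_empty] at this
  exact this ht hs

theorem Typed.caseOf_shared {Γ : Ctx} {t s r q : Tm} {A : Ty} (hΓ : Γ.Base) (hA : A.BoxFree)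
    (ht : Typed Γ t .nat) (hs : Typed Γ s A) (hr : Typed Γ r A) (hq : Typed Γ q A) :
    Typed Γ (.caseOf A t s r q) A := by
  have := Typed.caseOf (Γ := Γ) (Δ₁ := .empty) (Δ₂ := .empty) (Δ₃ := .empty) (Δ₄ := .empty)
    (t := t) (s := s) (r := r) (q := q) (A := A) (by simp [Ctx.disj_empty]) hΓ
  simp only [Ctx.union_empty] at this
  exact this ht hs hr hq hA

theorem Typed.recursion_shared {Γ : Ctx} {t s r : Tm} {A : Ty} (hΓ : Γ.Base) (hm : Γ.Le .modal)
    (hA : A.BoxFree) (ht : Typed Γ t .nat) (hs : Typed Γ s A)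
    (hr : Typed Γ r (.arr .modal .nat (.arr .nonmodal A A))) :
    Typed Γ (.recursion A t s r) A := by
  have := Typed.recursion (Γ₁ := Γ) (Γ₂ := .empty) (Δ₁ := .empty) (Δ₂ := .empty)
    (t := t) (s := s) (r := r) (A := A) (by simp [Ctx.disj_empty]) hΓ Ctx.base_empty
  simp only [Ctx.union_empty] at this
  exact this ht hs hr hm hA

/-- The context that consists of the `i`-th assignment of `Γ`. -/
def Ctx.only (Γ : Ctx) (i : ℕ) : Ctx := fun j => if j = i then Γ j else none

theorem Ctx.only_union_update (Γ : Ctx) (i : ℕ) :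
    (Γ.only i).union (Function.update Γ i none) = Γ := by
  funext j
  by_cases h : j = i
  · subst h; simp [Ctx.only, Ctx.union]
  · simp [Ctx.only, Ctx.union, h]

theorem Ctx.update_union_only (Γ : Ctx) (i : ℕ) :
    Ctx.union (Function.update Γ i none) (Γ.only i) = Γ := by
  funext j
  by_cases h : j = i
  · subst h; simp [Ctx.only, Ctx.union]
  · simp [Ctx.only, Ctx.union, h]

theorem Ctx.only_disj_update (Γ : Ctx) (i : ℕ) :
    (Γ.only i).Disj (Function.update Γ i none) := by
  intro j
  by_cases h : j = i
  · subst h; simp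
  · simp [Ctx.only, h]

theorem Ctx.update_disj_only (Γ : Ctx) (i : ℕ) :
    Ctx.Disj (Function.update Γ i none) (Γ.only i) :=
  fun j => (Ctx.only_disj_update Γ i j).symm

/-- A function may be applied to a modal variable of base type, whatever the context. -/
theorem Typed.app_modal_var {Γ : Ctx} {t : Tm} {i : ℕ} {G : BTy} {a : Aspect} {B : Ty}
    (hi : Γ i = some (.modal, .base G)) (ht : Typed Γ t (.arr a (.base G) B)) :
    Typed Γ (.app t (.var i)) B := by
  have ho : ∀ j b A, Γ.only i j = some (b, A) → b = .modal ∧ A = .base G := by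
    intro j b A h
    by_cases hj : j = i
    · subst hj; simp_all [Ctx.only]
    · simp [Ctx.only, hj] at h
  -- Only the modal variable is shared; all else goes to the function. The aspect condition then
  -- concerns this variable alone, and `t` may still use it.
  have := Typed.app (Γ := Γ.only i) (Δ₁ := Function.update Γ i none) (Δ₂ := .empty) (t := t)
    (s := .var i) (a := a) (A := .base G) (B := B)
    (by simp [Ctx.disj_empty, Ctx.only_disj_update])
    (fun j b A h => by rw [(ho j b A h).2]; trivial)
  simp only [Ctx.union_empty, Ctx.only_union_update] at this
  exact this ht (.var (a := .modal) (by simp [Ctx.only, hi])) fun j b A h => Or.inl (ho j b A h).1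

/-- Application of a function variable, which is used up. -/
theorem Typed.app_linear_var {Γ : Ctx} {s : Tm} {i : ℕ} {a : Aspect} {A B : Ty}
    (hi : Γ i = some (a, .arr .nonmodal A B)) (hb : Ctx.Base (Function.update Γ i none))
    (hs : Typed (Function.update Γ i none) s A) :
    Typed Γ (.app (.var i) s) B := by
  have := Typed.app (Γ := Function.update Γ i none) (Δ₁ := Γ.only i) (Δ₂ := .empty) (t := .var i)
    (s := s) (a := .nonmodal) (A := A) (B := B)
    (by simp [Ctx.disj_empty, Ctx.update_disj_only]) hb
  simp only [Ctx.union_empty, Ctx.update_union_only] at this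
  exact this (.var hi) hs (Ctx.le_nonmodal _)

/-! ### Evaluation trees -/

/-- `Ev f t μ`: a reduction tree of `t` has the leaves `f a`, with `a` distributed as `μ`. -/
inductive Ev {α : Type*} (f : α → Tm) : Tm → PMF α → Prop
  | ret (a : α) : Ev f (f a) (PMF.pure a)
  | step {t : Tm} {n : ℕ} {ts : Fin (n + 1) → Tm} {D : Fin (n + 1) → PMF α} :
      Red t ts → (∀ i, Ev f (ts i) (D i)) → Ev f t ((PMF.uniformOfFintype (Fin (n + 1))).bind D)

section Ev

variable {α β : Type*} {f : α → Tm} {g : β → Tm} {t s : Tm} {μ : PMF α}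

/-- Trees are grafted at the leaves. The hypothesis is limited to the support so that a
deterministic tree needs a continuation only at its one label. -/
theorem Ev.bind (h : Ev f t μ) {ν : α → PMF β} (hν : ∀ a ∈ μ.support, Ev g (f a) (ν a)) :
    Ev g t (μ.bind ν) := by
  induction h with
  | ret a => rw [PMF.pure_bind]; exact hν a (by simp)
  | step hr _ ih =>
    rw [PMF.bind_bind]
    refine .step hr fun i => ih i fun a ha => hν a ?_
    rw [PMF.mem_support_bind_iff]
    exact ⟨i, by simp, ha⟩

theorem Ev.of_pure {a : α} {ν : PMF β} (h : Ev f t (PMF.pure a)) (hν : Ev g (f a) ν) :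
    Ev g t ν := by
  have := h.bind (g := g) (ν := fun _ => ν) fun b hb => by
    rw [PMF.support_pure, Set.mem_singleton_iff] at hb
    rwa [hb]
  rwa [PMF.bind_const] at this

theorem Ev.of_red (h : Red t ![s]) (hs : Ev f s μ) : Ev f t μ := by
  have := Ev.step h (D := fun _ => μ) fun i => by fin_cases i; exact hs
  rwa [PMF.bind_const] at this

theorem Ev.eval (h : Ev f t μ) (hf : ∀ a, NF (f a)) : Eval t (μ.map f) := by
  induction h with
  | ret a => rw [PMF.pure_map]; exact .nf (hf a)
  | step hr _ ih => rw [PMF.map_bind]; exact .step hr ih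

/-- The tree is carried through an evaluation context; the leaves become redexes or parts of
redexes, and evaluation goes on from them by `Ev.bind` or `Ev.of_pure`. -/
theorem Ev.appL (h : Ev f t μ) (s : Tm) : Ev (fun a => .app (f a) s) (.app t s) μ := by
  induction h with
  | ret a => exact .ret (f := fun a => Tm.app (f a) s) a
  | step hr _ ih => exact .step (.appL s hr) ih

theorem Ev.appR (h : Ev f t μ) (s : Tm) : Ev (fun a => .app s (f a)) (.app s t) μ := by
  induction h with
  | ret a => exact .ret (f := fun a => Tm.app s (f a)) a
  | step hr _ ih => exact .step (.appR s hr) ih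

theorem Ev.caseArg (h : Ev f t μ) (A : Ty) (s r q : Tm) :
    Ev (fun a => .caseOf A (f a) s r q) (.caseOf A t s r q) μ := by
  induction h with
  | ret a => exact .ret (f := fun a => Tm.caseOf A (f a) s r q) a
  | step hr _ ih => exact .step (.case1 A s r q hr) ih

theorem Ev.pairL (h : Ev f t μ) (s : Tm) : Ev (fun a => .pair (f a) s) (.pair t s) μ := by
  induction h with
  | ret a => exact .ret (f := fun a => Tm.pair (f a) s) a
  | step hr _ ih => exact .step (.pairL s hr) ih

theorem Ev.pairR (h : Ev f t μ) (s : Tm) : Ev (fun a => .pair s (f a)) (.pair s t) μ := by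
  induction h with
  | ret a => exact .ret (f := fun a => Tm.pair s (f a)) a
  | step hr _ ih => exact .step (.pairR s hr) ih

theorem Ev.fst (h : Ev f t μ) : Ev (fun a => .fst (f a)) (.fst t) μ := by
  induction h with
  | ret a => exact .ret (f := fun a => Tm.fst (f a)) a
  | step hr _ ih => exact .step (.fst hr) ih

theorem Ev.snd (h : Ev f t μ) : Ev (fun a => .snd (f a)) (.snd t) μ := by
  induction h with
  | ret a => exact .ret (f := fun a => Tm.snd (f a)) a
  | step hr _ ih => exact .step (.snd hr) ih

theorem Ev.beta {b : Aspect} {G : BTy} {v : Tm} (hv : Value v) (h : Ev f (t.inst v) μ) :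
    Ev f (.app (.lam b (.base G) t) v) μ :=
  .of_red (.betaBase b G t v hv) h

end Ev

theorem NF.num (n : ℕ) : NF (.num n) := by
  intro m ts h
  cases h

end RSLR

namespace RSLR

open Tm

/-! ### Arithmetic on blocks of bits -/

/-- Remove the `w` lowest bits. -/
def popTm : ℕ → Tm → Tm
  | 0, t => t
  | w + 1, t => .app (.cst .P) (popTm w t)

/-- Append the `w` bits of `k` at the low end. -/
def pushTm : ℕ → ℕ → Tm → Tm
  | 0, _, t => t
  | w + 1, k, t => .app (.cst (if k % 2 = 0 then .S0 else .S1)) (pushTm w (k / 2) t)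

/-- Branch on the `w` lowest bits of `t`. -/
def dispatch (A : Ty) : ℕ → Tm → (ℕ → Tm) → Tm
  | 0, _, F => F 0
  | w + 1, t, F => .caseOf A t (F 0) (dispatch A w (.app (.cst .P) t) fun k => F (2 * k))
      (dispatch A w (.app (.cst .P) t) fun k => F (2 * k + 1))

/-- The number that consists of the `w` lowest bits of `t`. -/
def topTm (w : ℕ) (t : Tm) : Tm := dispatch .nat w t .num

theorem subst_popTm (w : ℕ) (t : Tm) (σ : ℕ → Tm) :
    (popTm w t).subst σ = popTm w (t.subst σ) := by
  induction w with
  | zero => rfl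
  | succ w ih => simp [popTm, Tm.subst, ih]

theorem subst_pushTm (w k : ℕ) (t : Tm) (σ : ℕ → Tm) :
    (pushTm w k t).subst σ = pushTm w k (t.subst σ) := by
  induction w generalizing k with
  | zero => rfl
  | succ w ih => simp [pushTm, Tm.subst, ih]

theorem subst_dispatch (A : Ty) (w : ℕ) (t : Tm) (F : ℕ → Tm) (σ : ℕ → Tm) :
    (dispatch A w t F).subst σ = dispatch A w (t.subst σ) fun k => (F k).subst σ := by
  induction w generalizing t F with
  | zero => rfl
  | succ w ih => simp [dispatch, Tm.subst, ih]

theorem subst_topTm (w : ℕ) (t : Tm) (σ : ℕ → Tm) :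
    (topTm w t).subst σ = topTm w (t.subst σ) :=
  subst_dispatch _ _ _ _ _

section Typing

variable {Γ : Ctx} {t : Tm}

theorem Typed.app_cst {c : Cst} (hΓ : Γ.Base) (hc : c.ty = .arr .nonmodal .nat .nat)
    (ht : Typed Γ t .nat) : Typed Γ (.app (.cst c) t) .nat :=
  .app_shared hΓ Γ.le_nonmodal (hc ▸ .cst c) ht

theorem Typed.popTm (hΓ : Γ.Base) (w : ℕ) (ht : Typed Γ t .nat) :
    Typed Γ (RSLR.popTm w t) .nat := by
  induction w with
  | zero => exact ht
  | succ w ih => exact .app_cst hΓ rfl ih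

theorem Typed.pushTm (hΓ : Γ.Base) (w k : ℕ) (ht : Typed Γ t .nat) :
    Typed Γ (RSLR.pushTm w k t) .nat := by
  induction w generalizing k with
  | zero => exact ht
  | succ w ih => exact .app_cst hΓ (by split_ifs <;> rfl) (ih _)

theorem Typed.dispatch (hΓ : Γ.Base) {A : Ty} (hA : A.BoxFree) (w : ℕ) {F : ℕ → Tm}
    (ht : Typed Γ t .nat) (hF : ∀ k, Typed Γ (F k) A) : Typed Γ (RSLR.dispatch A w t F) A := by
  induction w generalizing t F with
  | zero => exact hF 0
  | succ w ih =>
    exact .caseOf_shared hΓ hA ht (hF 0) (ih (.app_cst hΓ rfl ht) fun _ => hF _)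
      (ih (.app_cst hΓ rfl ht) fun _ => hF _)

theorem Typed.topTm (hΓ : Γ.Base) (w : ℕ) (ht : Typed Γ t .nat) :
    Typed Γ (RSLR.topTm w t) .nat :=
  .dispatch hΓ (A := .nat) trivial w ht fun _ => .cst _

end Typing

section Evaluation

variable {α : Type*} {f : α → Tm} {t : Tm} {m : ℕ} {μ : PMF α}

theorem Ev.P (h : Ev num t (PMF.pure m)) : Ev num (.app (.cst .P) t) (PMF.pure (m / 2)) :=
  (h.appR _).of_pure (.of_red (.P m) (.ret _))

theorem Ev.S0 (h : Ev num t (PMF.pure m)) : Ev num (.app (.cst .S0) t) (PMF.pure (2 * m)) :=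
  (h.appR _).of_pure (.of_red (.S0 m) (.ret _))

theorem Ev.S1 (h : Ev num t (PMF.pure m)) : Ev num (.app (.cst .S1) t) (PMF.pure (2 * m + 1)) :=
  (h.appR _).of_pure (.of_red (.S1 m) (.ret _))

theorem Ev.popTm (h : Ev num t (PMF.pure m)) (w : ℕ) :
    Ev num (popTm w t) (PMF.pure (m / 2 ^ w)) := by
  induction w with
  | zero => simpa [RSLR.popTm] using h
  | succ w ih => rw [pow_succ, ← Nat.div_div_eq_div_mul]; exact ih.P

theorem Ev.pushTm (h : Ev num t (PMF.pure m)) (w k : ℕ) (hk : k < 2 ^ w) :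
    Ev num (pushTm w k t) (PMF.pure (m * 2 ^ w + k)) := by
  induction w generalizing k with
  | zero => obtain rfl : k = 0 := by simpa using hk
            simpa [RSLR.pushTm] using h
  | succ w ih =>
    have ih := ih (k / 2) (by rw [pow_succ] at hk; omega)
    rw [RSLR.pushTm]
    rcases Nat.even_or_odd' k with ⟨j, rfl | rfl⟩
    · rw [if_pos (by omega)]
      convert ih.S0 using 2
      rw [pow_succ]; simp; ring
    · rw [if_neg (by omega)]
      convert ih.S1 using 2
      rw [pow_succ, show (2 * j + 1) / 2 = j by omega]; ring

/-- Each case reads the lowest bit and P shifts to the next one. The zero branch can stop early with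
`F 0`, as all remaining bits are 0. -/
theorem Ev.dispatch (A : Ty) (w : ℕ) {F : ℕ → Tm} (h : Ev num t (PMF.pure m))
    (hF : Ev f (F (m % 2 ^ w)) μ) : Ev f (dispatch A w t F) μ := by
  induction w generalizing t m F with
  | zero => simpa [RSLR.dispatch, Nat.mod_one] using hF
  | succ w ih =>
    refine (h.caseArg A _ _ _).of_pure ?_
    have e : m % 2 ^ (w + 1) = m % 2 + 2 * (m / 2 % 2 ^ w) := by
      rw [pow_succ', Nat.mod_mul]
    rw [e] at hF
    rcases Nat.even_or_odd' m with ⟨j, rfl | rfl⟩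
    · rcases Nat.eq_zero_or_pos j with rfl | hj
      · exact .of_red (.caseZero _ _ _ _) (by simpa using hF)
      · refine .of_red (.caseEven _ j _ _ _ hj.ne') (ih h.P ?_)
        simpa using hF
    · refine .of_red (.caseOdd _ j _ _ _) (ih h.P ?_)
      rwa [show (2 * j + 1) % 2 = 1 by omega, Nat.add_comm 1] at hF

theorem Ev.topTm (h : Ev num t (PMF.pure m)) (w : ℕ) :
    Ev num (topTm w t) (PMF.pure (m % 2 ^ w)) :=
  .dispatch _ _ h (.ret _)

end Evaluation

/-! ### Loops -/

/-- Recursion on notation with a parameter of base type `G`: on `n` and `c`, apply `F n ⌊n/2ⁱ⌋` to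
`c` for `i = 0, 1, …` as long as `⌊n/2ⁱ⌋ ≠ 0`, and then `B n`. -/
def loopTm (G : BTy) (B F : Tm) : Tm :=
  .lam .modal .nat (.recursion (.arr .nonmodal (.base G) (.base G)) (.var 0) (.app B (.var 0))
    (.lam .modal .nat (.lam .nonmodal (.arr .nonmodal (.base G) (.base G))
      (.lam .nonmodal (.base G)
        (.app (.var 1) (.app (.app (.app F (.var 3)) (.var 2)) (.var 0)))))))

theorem typed_loopTm {G : BTy} {B F : Tm}
    (hB : Typed .empty B (.arr .modal .nat (.arr .nonmodal (.base G) (.base G))))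
    (hF : Typed .empty F
      (.arr .modal .nat (.arr .modal .nat (.arr .nonmodal (.base G) (.base G))))) :
    Typed .empty (loopTm G B F) (.arr .modal .nat (.arr .nonmodal (.base G) (.base G))) := by
  refine .lam (.recursion_shared (Ctx.base_empty.cons _ _) ((Ctx.le_empty _).cons_modal _)
    ⟨rfl, trivial, trivial⟩ (.var rfl) (.app_modal_var rfl (hB.closed _)) (.lam (.lam (.lam ?_))))
  -- Variable `1`, the recursive value, is the only one of function type. Once it is removed, the
  -- rest can be shared.
  have hb : ∀ a, Ctx.Base (Function.update (Ctx.cons .nonmodal (.base G)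
      (Ctx.cons .nonmodal (.arr .nonmodal (.base G) (.base G))
        (Ctx.cons .modal .nat (Ctx.cons a .nat .empty)))) 1 none) := by
    rintro a (_ | _ | _ | _ | i) b A h <;> cases h <;> trivial
  refine .app_linear_var (A := .base G) rfl (hb _) (.app_shared (hb _) (Ctx.le_nonmodal _)
    (.app_modal_var rfl (.app_modal_var rfl (hF.closed _))) (.var rfl))

/-- The distribution computed by a loop. -/
noncomputable def loop {α : Type*} (β : α → PMF α) (φ : ℕ → α → PMF α) (x : ℕ) (a : α) : PMF α :=
  if x = 0 then β a else (φ x a).bind (loop β φ (x / 2))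
termination_by x
decreasing_by exact Nat.div_lt_self (Nat.pos_of_ne_zero ‹_›) one_lt_two

/-- The recursive call is substituted unevaluated, since it has a function type, whereas the
parameter is evaluated first. Hence each unfolding applies the smaller recursion to a value, and the
induction hypothesis applies at every outcome. -/
theorem ev_loopTm {G : BTy} {B F : Tm} (hBc : B.Closed) (hFc : F.Closed) {α : Type*}
    {enc : α → Tm} (henc : ∀ a, Value (enc a)) {n : ℕ} {β : α → PMF α} {φ : ℕ → α → PMF α}
    (hB : ∀ a, Ev enc (.app (.app B (.num n)) (enc a)) (β a))
    (hF : ∀ x a, Ev enc (.app (.app (.app F (.num n)) (.num x)) (enc a)) (φ x a)) (a : α) :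
    Ev enc (.app (.app (loopTm G B F) (.num n)) (enc a)) (loop β φ n a) := by
  set T : Ty := .arr .nonmodal (.base G) (.base G) with hT
  set R : Tm := .lam .modal .nat (.lam .nonmodal T (.lam .nonmodal (.base G)
        (.app (.var 1) (.app (.app (.app F (.num n)) (.var 2)) (.var 0))))) with hR
  have key : ∀ x a, Ev enc (.app (.recursion T (.num x) (.app B (.num n)) R) (enc a))
      (loop β φ x a) := by
    intro x
    induction x using Nat.strong_induction_on with
    | _ x ih =>
      intro a
      rw [loop]
      split_ifs with hx
      · subst hx
        exact ((Ev.of_red (f := id) (.recZero _ _ _) (.ret (f := id) _)).appL _).of_pure (hB a)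
      · refine ((Ev.of_red (f := id) (.recStep _ x _ _ hx) (.ret (f := id) _)).appL _).of_pure ?_
        set r : Tm := .recursion T (.num (x / 2)) (.app B (.num n)) R with hr
        -- The call `r` is substituted under the binder of the parameter and then meets the
        -- substitution for the parameter; being closed, it survives both.
        have hrc : r.Closed := by
          intro σ
          simp [hr, hR, Tm.subst, hBc _, hFc _, Tm.upSubst, Tm.rename]
        have h1 : Ev id (.app R (.num x)) (PMF.pure (.lam .nonmodal T (.lam .nonmodal (.base G)
            (.app (.var 1) (.app (.app (.app F (.num n)) (.num x)) (.var 0)))))) := by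
          refine .beta (.num x) ?_
          have := Ev.ret (f := id) (Tm.lam .nonmodal T (.lam .nonmodal (.base G)
            (.app (.var 1) (.app (.app (.app F (.num n)) (.num x)) (.var 0)))))
          simpa [Tm.inst, Tm.subst, hFc _, Tm.upSubst, Tm.rename, Tm.single] using this
        refine ((h1.appL _).appL _).of_pure ?_
        have h2 : Ev id (.app (.lam .nonmodal T (.lam .nonmodal (.base G)
            (.app (.var 1) (.app (.app (.app F (.num n)) (.num x)) (.var 0))))) r)
            (PMF.pure (.lam .nonmodal (.base G)
              (.app r (.app (.app (.app F (.num n)) (.num x)) (.var 0))))) := by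
          refine .of_red (.betaArr _ _ _ _ _ _) ?_
          have := Ev.ret (f := id) (Tm.lam .nonmodal (.base G)
            (.app r (.app (.app (.app F (.num n)) (.num x)) (.var 0))))
          simpa [Tm.inst, Tm.subst, hFc _, Tm.upSubst, Tm.rename, Tm.single,
            hrc.rename] using this
        refine (h2.appL _).of_pure (.beta (henc a) ?_)
        -- One round is run in argument position, and the remaining rounds are grafted on its
        -- outcomes.
        have h3 := ((hF x a).appR r).bind (g := enc) (ν := loop β φ (x / 2)) fun a' _ =>
          ih (x / 2) (Nat.div_lt_self (Nat.pos_of_ne_zero hx) one_lt_two) a'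
        simpa [Tm.inst, Tm.subst, hFc _, hrc _, Tm.single] using h3
  refine (((Ev.beta (.num n) (?_ : Ev id _ (PMF.pure
    (.recursion T (.num n) (.app B (.num n)) R)))).appL _).of_pure (key n a))
  have := Ev.ret (f := id) (Tm.recursion T (.num n) (.app B (.num n)) R)
  simpa [Tm.inst, Tm.subst, hFc _, hBc _, hR, hT, Tm.upSubst, Tm.rename, Tm.single] using this

theorem Ev.beta_num {a : Aspect} (t : Tm) (n : ℕ) :
    Ev id (.app (.lam a .nat t) (.num n)) (PMF.pure (t.inst (.num n))) :=
  .beta (.num n) (.ret (f := id) _)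

end RSLR

/-! ### Polynomial bounds and binary length -/

open Polynomial in
-- The base `s + 2` is at least 2 even for `s = 0`, so constant factors are absorbed into the
-- exponent.
theorem Polynomial.exists_eval_le_pow (p : ℕ[X]) : ∃ k : ℕ, ∀ s, p.eval s ≤ (s + 2) ^ k := by
  induction p using Polynomial.induction_on' with
  | add p q hp hq =>
    obtain ⟨i, hi⟩ := hp
    obtain ⟨j, hj⟩ := hq
    refine ⟨max i j + 1, fun s => ?_⟩
    have h1 : (s + 2) ^ i ≤ (s + 2) ^ max i j := Nat.pow_le_pow_right (by omega) (le_max_left _ _)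
    have h2 : (s + 2) ^ j ≤ (s + 2) ^ max i j := Nat.pow_le_pow_right (by omega) (le_max_right _ _)
    calc (p + q).eval s ≤ (s + 2) ^ max i j * 2 := by
          rw [Polynomial.eval_add]; linarith [hi s, hj s]
      _ ≤ (s + 2) ^ (max i j + 1) := by
          rw [pow_succ]; exact Nat.mul_le_mul_left _ (by omega)
  | monomial d a =>
    refine ⟨a + d, fun s => ?_⟩
    rw [Polynomial.eval_monomial, pow_add]
    refine Nat.mul_le_mul ?_ (Nat.pow_le_pow_left (by omega) d)
    exact (Nat.lt_two_pow_self).le.trans (Nat.pow_le_pow_left (by omega) a)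

theorem Nat.size_eq_size_half_add_one {n : ℕ} (hn : n ≠ 0) : n.size = (n / 2).size + 1 := by
  conv_lhs => rw [← Nat.bit_bodd_div2 n]
  rw [Nat.size_bit (by rwa [Nat.bit_bodd_div2]), Nat.div2_val]

/-! ### Runs of a machine and the coding of tapes by numbers -/

namespace PTM.Machine

variable {Q S : Type*} (M : Machine Q S)

/-- The distribution of configurations `T` steps after `c`. -/
noncomputable def runFrom (c : Cfg Q S) : ℕ → PMF (Cfg Q S)
  | 0 => PMF.pure c
  | T + 1 => (runFrom c T).bind M.stepDist

theorem runFrom_one (c : Cfg Q S) : M.runFrom c 1 = M.stepDist c :=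
  PMF.pure_bind _ _

theorem runFrom_add (c : Cfg Q S) (T U : ℕ) :
    M.runFrom c (T + U) = (M.runFrom c T).bind fun d => M.runFrom d U := by
  induction U with
  | zero => simp [runFrom]
  | succ U ih => rw [← add_assoc, runFrom, ih, PMF.bind_bind]; rfl

theorem runFrom_initial (n T : ℕ) : M.runFrom (M.initial n) T = M.run n T := by
  induction T with
  | zero => rfl
  | succ T ih => rw [runFrom, ih, run]

theorem run_add_of_haltsWithin {n T : ℕ} (h : M.HaltsWithin n T) (U : ℕ) :
    M.run n (T + U) = M.run n T := by
  induction U with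
  | zero => rfl
  | succ U ih =>
    rw [← add_assoc, run, ih]
    -- Both sides are binds over the same distribution; they need to agree on its support only,
    -- where all configurations are final.
    conv_rhs => rw [← PMF.bind_pure (M.run n T)]
    ext d
    rw [PMF.bind_apply, PMF.bind_apply]
    refine tsum_congr fun c => ?_
    by_cases hc : c ∈ (M.run n T).support
    · rw [stepDist, if_pos (h c hc)]
    · rw [PMF.mem_support_iff, not_not] at hc
      simp [hc]

theorem resultDist_eq {n T : ℕ} (hT : M.HaltsWithin n T) (h : ∃ T, M.HaltsWithin n T) :
    M.resultDist n h = (M.run n T).map M.result := by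
  classical
  have hle : Nat.find h ≤ T := Nat.find_le hT
  obtain ⟨U, hU⟩ := Nat.exists_eq_add_of_le hle
  rw [hU, run_add_of_haltsWithin M (Nat.find_spec h)]
  unfold resultDist
  congr!

/-- Numbers for the states and symbols of a machine, with `width` bits each; the blank is `0`. -/
structure Coding where
  width : ℕ
  width_pos : 0 < width
  state : Q → ℕ
  symbol : S → ℕ
  state_injective : Function.Injective state
  symbol_injective : Function.Injective symbol
  state_lt : ∀ q, state q < 2 ^ width
  symbol_lt : ∀ s, symbol s < 2 ^ width
  symbol_blank : symbol M.blank = 0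

theorem nonempty_coding [Finite Q] [Finite S] : Nonempty M.Coding := by
  classical
  obtain ⟨m, ⟨e⟩⟩ := Finite.exists_equiv_fin Q
  obtain ⟨n, ⟨f⟩⟩ := Finite.exists_equiv_fin S
  -- The codes are at most `m + n`, as the blank takes 0 and the other symbols are shifted by one.
  -- The summand 1 keeps the width positive.
  have hlt : ∀ x, x ≤ m + n + 1 → x < 2 ^ (m + n + 1) := fun x hx =>
    hx.trans_lt Nat.lt_two_pow_self
  refine ⟨⟨m + n + 1, by omega, fun q => e q, fun s => if s = M.blank then 0 else f s + 1, ?_, ?_,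
    fun q => hlt _ ?_, fun s => hlt _ ?_, if_pos rfl⟩⟩
  · intro q r h
    exact e.injective (Fin.ext h)
  · intro s r h
    dsimp only at h
    split_ifs at h with h1 h2 h2
    · rw [h1, h2]
    · exact f.injective (Fin.ext (by omega))
  · have := (e q).isLt
    omega
  · have := (f s).isLt
    split_ifs <;> omega

namespace Coding

variable {M} (K : M.Coding)

/-- A list of symbols as a number, the first symbol in the lowest bits. -/
def list : List S → ℕ
  | [] => 0
  | s :: l => list l * 2 ^ K.width + K.symbol s

/-- Since the blank has code 0, the empty list behaves like a blank cell followed by blanks. -/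
theorem list_mod (l : List S) : K.list l % 2 ^ K.width = K.symbol (l.headD M.blank) := by
  cases l with
  | nil => simp [list, K.symbol_blank]
  | cons s l =>
    rw [list, Nat.mul_add_mod', Nat.mod_eq_of_lt (K.symbol_lt s)]; rfl

theorem list_div (l : List S) : K.list l / 2 ^ K.width = K.list l.tail := by
  cases l with
  | nil => simp [list]
  | cons s l =>
    rw [list, Nat.mul_comm, Nat.mul_add_div (by positivity), Nat.div_eq_of_lt (K.symbol_lt s)]
    rfl

theorem symbol_digit_ne_zero (b : Bool) : K.symbol (M.digit b) ≠ 0 := fun h =>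
  M.digit_ne_blank b (K.symbol_injective (h.trans K.symbol_blank.symm))

/-- A nonzero block makes the number at least one bit longer. Digits have nonzero codes, so the
length of the tape number bounds the number of digits to be read. -/
theorem size_list_lt {s : S} (l : List S) (h : K.symbol s ≠ 0) :
    (K.list l).size < (K.list (s :: l)).size := by
  rw [Nat.lt_size, list]
  rcases Nat.eq_zero_or_pos (K.list l) with h0 | h0
  · simp [h0]; omega
  · have h1 : 2 ^ (K.list l).size ≤ K.list l * 2 := by
      obtain ⟨j, hj⟩ := Nat.exists_eq_succ_of_ne_zero (Nat.size_pos.2 h0).ne'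
      have : 2 ^ j ≤ K.list l := Nat.lt_size.1 (by omega)
      rw [hj, pow_succ]
      omega
    have h2 : 2 ^ 1 ≤ 2 ^ K.width := Nat.pow_le_pow_right (by omega) K.width_pos
    calc 2 ^ (K.list l).size ≤ K.list l * 2 := h1
      _ ≤ K.list l * 2 ^ K.width := Nat.mul_le_mul_left _ h2
      _ ≤ _ := Nat.le_add_right _ _

/-- One step of reading the result: the rest of the tape and the value read so far. -/
def readStep (x : ℕ × ℕ) : ℕ × ℕ :=
  if x.1 % 2 ^ K.width = K.symbol (M.digit false) then (x.1 / 2 ^ K.width, 2 * x.2)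
  else if x.1 % 2 ^ K.width = K.symbol (M.digit true) then (x.1 / 2 ^ K.width, 2 * x.2 + 1)
  else x

/-- Every digit read shortens the tape number, so `N` rounds suffice. At the first non-digit the
state is a fixed point, and further rounds do nothing. -/
theorem readStep_iterate (l : List S) : ∀ (k N : ℕ), (K.list l).size ≤ N →
    (K.readStep^[N] (K.list l, k)).2 = M.readFrom k l := by
  have fixed : ∀ x N, K.readStep x = x → (K.readStep^[N] x).2 = x.2 := fun x N h => by
    rw [Function.iterate_fixed h]
  induction l with
  | nil =>
    intro k N _
    rw [fixed]
    · rfl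
    · simp [readStep, list, (K.symbol_digit_ne_zero _).symm]
  | cons s l ih =>
    intro k N hN
    have hm : K.list (s :: l) % 2 ^ K.width = K.symbol s := K.list_mod _
    have hd : K.list (s :: l) / 2 ^ K.width = K.list l := K.list_div _
    have inj : ∀ b, K.symbol s = K.symbol (M.digit b) ↔ s = M.digit b := fun b =>
      K.symbol_injective.eq_iff
    have stp : ∀ b, s = M.digit b → ∃ N', N = N' + 1 ∧ (K.list l).size ≤ N' := by
      rintro b rfl
      have := K.size_list_lt l (K.symbol_digit_ne_zero b)
      exact ⟨N - 1, by omega, by omega⟩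
    have stp0 : s = M.digit false → K.readStep (K.list (s :: l), k) = (K.list l, 2 * k) :=
      fun h => by rw [readStep, if_pos (by rw [hm, h]), hd]
    have stp1 : s = M.digit true → K.readStep (K.list (s :: l), k) = (K.list l, 2 * k + 1) :=
      fun h => by
        rw [readStep, if_neg (by rw [hm, inj, h, M.digit_injective.eq_iff]; decide),
          if_pos (by rw [hm, h]), hd]
    rw [readFrom]
    split_ifs with h0 h1
    · obtain ⟨N', rfl, hN'⟩ := stp _ h0
      rw [Function.iterate_succ_apply, ← ih _ _ hN']
      rw [stp0 h0]
    · obtain ⟨N', rfl, hN'⟩ := stp _ h1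
      rw [Function.iterate_succ_apply, ← ih _ _ hN']
      rw [stp1 h1]
    · rw [fixed]
      rw [readStep, if_neg (by rwa [hm, inj]), if_neg (by rwa [hm, inj])]

end Coding

end PTM.Machine

namespace RSLR

open Tm PTM

/-! ### The simulation of a machine -/

/-- Base type of configurations: state, scanned symbol, left and right part of the tape. -/
def cfgTy : BTy := .prod .nat (.prod .nat (.prod .nat .nat))

def quad (q h l r : Tm) : Tm := .pair q (.pair h (.pair l r))

section Quad

theorem Typed.quad {Γ : Ctx} {q h l r : Tm} (hΓ : Γ.Base) (hq : Typed Γ q .nat)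
    (hh : Typed Γ h .nat) (hl : Typed Γ l .nat) (hr : Typed Γ r .nat) :
    Typed Γ (RSLR.quad q h l r) (.base cfgTy) :=
  .pair_shared hΓ hq (.pair_shared hΓ hh (.pair_shared hΓ hl hr))

theorem Ev.quad {α : Type*} {f : α → Tm} {μ : PMF α} {q h l r : Tm} {q' h' l' r' : ℕ}
    (hq : Ev num q (PMF.pure q')) (hh : Ev num h (PMF.pure h')) (hl : Ev num l (PMF.pure l'))
    (hr : Ev num r (PMF.pure r'))
    (H : Ev f (RSLR.quad (.num q') (.num h') (.num l') (.num r')) μ) :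
    Ev f (RSLR.quad q h l r) μ :=
  (hq.pairL _).of_pure <| ((hh.pairL _).pairR _).of_pure <|
    (((hl.pairL _).pairR _).pairR _).of_pure <| (((hr.pairR _).pairR _).pairR _).of_pure H

variable (c : Tm)

def stateOf : Tm := .fst c
def headOf : Tm := .fst (.snd c)
def leftOf : Tm := .fst (.snd (.snd c))
def rightOf : Tm := .snd (.snd (.snd c))

variable {c} {Γ : Ctx}

theorem Typed.stateOf (h : Typed Γ c (.base cfgTy)) : Typed Γ (RSLR.stateOf c) .nat := .fst h
theorem Typed.headOf (h : Typed Γ c (.base cfgTy)) : Typed Γ (RSLR.headOf c) .nat := .fst (.snd h)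
theorem Typed.leftOf (h : Typed Γ c (.base cfgTy)) : Typed Γ (RSLR.leftOf c) .nat :=
  .fst (.snd (.snd h))
theorem Typed.rightOf (h : Typed Γ c (.base cfgTy)) : Typed Γ (RSLR.rightOf c) .nat :=
  .snd (.snd (.snd h))

theorem ev_snd_pair (t s : Tm) : Ev id (.snd (.pair t s)) (PMF.pure s) :=
  .of_red (.sndPair t s) (.ret (f := id) s)

theorem ev_fst_num (n : ℕ) (s : Tm) : Ev num (.fst (.pair (.num n) s)) (PMF.pure n) :=
  .of_red (.fstPair _ s) (.ret n)

theorem ev_snd_num (t : Tm) (n : ℕ) : Ev num (.snd (.pair t (.num n))) (PMF.pure n) :=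
  .of_red (.sndPair t _) (.ret n)

variable (q h l r : ℕ)

theorem ev_stateOf : Ev num (stateOf (quad (.num q) (.num h) (.num l) (.num r))) (PMF.pure q) :=
  ev_fst_num _ _

theorem ev_headOf : Ev num (headOf (quad (.num q) (.num h) (.num l) (.num r))) (PMF.pure h) :=
  (ev_snd_pair _ _).fst.of_pure (ev_fst_num _ _)

theorem ev_leftOf : Ev num (leftOf (quad (.num q) (.num h) (.num l) (.num r))) (PMF.pure l) :=
  (ev_snd_pair _ _).snd.fst.of_pure ((ev_snd_pair _ _).fst.of_pure (ev_fst_num _ _))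

theorem ev_rightOf : Ev num (rightOf (quad (.num q) (.num h) (.num l) (.num r))) (PMF.pure r) :=
  (ev_snd_pair _ _).snd.snd.of_pure ((ev_snd_pair _ _).snd.of_pure (ev_snd_num _ _))

end Quad

theorem bind_uniform_fin_two {α : Type*} (g : Bool → α) (f : Fin 2 → PMF α)
    (h0 : f 0 = PMF.pure (g false)) (h1 : f 1 = PMF.pure (g true)) :
    (PMF.uniformOfFintype (Fin 2)).bind f = (PMF.uniformOfFintype Bool).map g := by
  ext x
  simp [PMF.bind_apply, PMF.map, tsum_fintype, Fin.sum_univ_two, h0, h1, add_comm]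

variable {Q S : Type*} {M : Machine Q S} (K : M.Coding)

/-- The value that represents a configuration. -/
def encode (c : Cfg Q S) : Tm :=
  quad (.num (K.state c.state)) (.num (K.symbol c.head)) (.num (K.list c.left))
    (.num (K.list c.right))

theorem value_encode (c : Cfg Q S) : Value (encode K c) :=
  .pair (.num _) (.pair (.num _) (.pair (.num _) (.num _)))

/-- The configuration after an action. -/
def actTm (c : Tm) : Q × S × Move → Tm
  | (q, s, .left) => quad (.num (K.state q)) (topTm K.width (leftOf c)) (popTm K.width (leftOf c))
      (pushTm K.width (K.symbol s) (rightOf c))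
  | (q, s, .stay) => quad (.num (K.state q)) (.num (K.symbol s)) (leftOf c) (rightOf c)
  | (q, s, .right) => quad (.num (K.state q)) (topTm K.width (rightOf c))
      (pushTm K.width (K.symbol s) (leftOf c)) (popTm K.width (rightOf c))

theorem subst_actTm (c : Tm) (a : Q × S × Move) (σ : ℕ → Tm) :
    (actTm K c a).subst σ = actTm K (c.subst σ) a := by
  obtain ⟨q, s, _ | _ | _⟩ := a <;>
    simp [actTm, quad, Tm.subst, subst_topTm, subst_popTm, subst_pushTm, leftOf, rightOf]

theorem Typed.actTm {Γ : Ctx} {c : Tm} (hΓ : Γ.Base) (hc : Typed Γ c (.base cfgTy))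
    (a : Q × S × Move) : Typed Γ (RSLR.actTm K c a) (.base cfgTy) := by
  obtain ⟨q, s, _ | _ | _⟩ := a
  · exact .quad hΓ (.cst _) (.topTm hΓ _ hc.leftOf) (.popTm hΓ _ hc.leftOf)
      (.pushTm hΓ _ _ hc.rightOf)
  · exact .quad hΓ (.cst _) (.cst _) hc.leftOf hc.rightOf
  · exact .quad hΓ (.cst _) (.topTm hΓ _ hc.rightOf) (.pushTm hΓ _ _ hc.leftOf)
      (.popTm hΓ _ hc.rightOf)

/-- A move pops a block from one stack and pushes the written symbol on the other; `list_mod` and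
`list_div` identify the popped block and the remainder with `headD` and `tail`. -/
theorem ev_actTm (c : Cfg Q S) (b : Bool) :
    Ev (encode K) (actTm K (encode K c) (M.trans c.state c.head b)) (PMF.pure (M.next c b)) := by
  have hl : Ev num (leftOf (encode K c)) _ := ev_leftOf _ _ _ _
  have hr : Ev num (rightOf (encode K c)) _ := ev_rightOf _ _ _ _
  rcases e : M.trans c.state c.head b with ⟨q, s, _ | _ | _⟩ <;>
    simp only [Machine.next, e] <;> rw [actTm]
  · refine .quad (.ret _) (hl.topTm _) (hl.popTm _) (hr.pushTm _ _ (K.symbol_lt s)) ?_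
    rw [K.list_mod, K.list_div]
    exact .ret (f := encode K) ⟨q, c.left.tail, c.left.headD M.blank, s :: c.right⟩
  · exact .quad (.ret _) (.ret _) hl hr (.ret (f := encode K) ⟨q, c.left, s, c.right⟩)
  · refine .quad (.ret _) (hr.topTm _) (hl.pushTm _ _ (K.symbol_lt s)) (hr.popTm _) ?_
    rw [K.list_mod, K.list_div]
    exact .ret (f := encode K) ⟨q, s :: c.left, c.right.headD M.blank, c.right.tail⟩

open Classical in
/-- The configuration after one step of the machine. -/
noncomputable def stepBody (c : Tm) : Tm :=
  dispatch (.base cfgTy) K.width (stateOf c) fun i => dispatch (.base cfgTy) K.width (headOf c)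
    fun j =>
      haveI : Nonempty Q := ⟨M.start⟩
      haveI : Nonempty S := ⟨M.blank⟩
      let q := Function.invFun K.state i
      let s := Function.invFun K.symbol j
      if q ∈ M.final then c
      else .caseOf (.base cfgTy) (.cst .rand) (actTm K c (M.trans q s false))
        (actTm K c (M.trans q s false)) (actTm K c (M.trans q s true))

theorem subst_stepBody (c : Tm) (σ : ℕ → Tm) :
    (stepBody K c).subst σ = stepBody K (c.subst σ) := by
  simp only [stepBody, subst_dispatch, stateOf, headOf, Tm.subst]
  congr! 4
  split_ifs
  · rfl
  · simp [Tm.subst, subst_actTm]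

theorem ev_stepBody (c : Cfg Q S) : Ev (encode K) (stepBody K (encode K c)) (M.stepDist c) := by
  have : Nonempty Q := ⟨M.start⟩
  have : Nonempty S := ⟨M.blank⟩
  refine .dispatch _ _ (ev_stateOf _ _ _ _) (.dispatch _ _ (ev_headOf _ _ _ _) ?_)
  rw [Nat.mod_eq_of_lt (K.state_lt _), Nat.mod_eq_of_lt (K.symbol_lt _)]
  dsimp only
  rw [Function.leftInverse_invFun K.state_injective, Function.leftInverse_invFun K.symbol_injective,
    Machine.stepDist]
  split_ifs with h
  · exact .ret (f := encode K) c
  -- The outcomes 0 and 1 of rand select the zero and odd branches; the even branch is never taken.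
  · rw [← bind_uniform_fin_two (M.next c)
      ![PMF.pure (M.next c false), PMF.pure (M.next c true)] rfl rfl]
    refine .step (.case1 _ _ _ _ .rand) fun i => ?_
    fin_cases i
    · exact .of_red (.caseZero _ _ _ _) (ev_actTm K c false)
    · exact .of_red (.caseOdd _ 0 _ _ _) (ev_actTm K c true)

/-- One step of the machine. -/
noncomputable def stepTm : Tm := .lam .nonmodal (.base cfgTy) (stepBody K (.var 0))

theorem typed_stepTm :
    Typed .empty (stepTm K) (.arr .nonmodal (.base cfgTy) (.base cfgTy)) := by
  have hΓ := Ctx.base_empty.cons .nonmodal cfgTy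
  refine .lam (.dispatch hΓ (A := .base cfgTy) trivial _ (.stateOf (.var rfl)) fun i =>
    .dispatch hΓ (A := .base cfgTy) trivial _
    (.headOf (.var rfl)) fun j => ?_)
  dsimp only
  split_ifs
  · exact .var rfl
  · exact .caseOf_shared hΓ trivial (.cst .rand) (.actTm K hΓ (.var rfl) _)
      (.actTm K hΓ (.var rfl) _) (.actTm K hΓ (.var rfl) _)

theorem ev_stepTm (c : Cfg Q S) :
    Ev (encode K) (.app (stepTm K) (encode K c)) (M.stepDist c) := by
  refine .beta (value_encode K c) ?_
  rw [Tm.inst, subst_stepBody]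
  exact ev_stepBody K c

/-- On input `n`, the function that makes `(|n| + 2) ^ k` steps. -/
noncomputable def stepsTm : ℕ → Tm
  | 0 => .lam .modal .nat (stepTm K)
  | k + 1 => loopTm cfgTy
      (.lam .modal .nat (.lam .nonmodal (.base cfgTy) (.app (.app (stepsTm k) (.var 1))
        (.app (.app (stepsTm k) (.var 1)) (.var 0)))))
      (.lam .modal .nat (.lam .modal .nat (.app (stepsTm k) (.var 1))))

/-- The term for `k` occurs twice in the base part; this is allowed because it is closed and its
argument is a modal variable of base type. -/
theorem typed_stepsTm_succ (k : ℕ) (h : Typed .empty (stepsTm K k)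
    (.arr .modal .nat (.arr .nonmodal (.base cfgTy) (.base cfgTy)))) :
    Typed .empty (.lam .modal .nat (.lam .nonmodal (.base cfgTy) (.app (.app (stepsTm K k) (.var 1))
      (.app (.app (stepsTm K k) (.var 1)) (.var 0)))))
      (.arr .modal .nat (.arr .nonmodal (.base cfgTy) (.base cfgTy))) ∧
    Typed .empty (.lam .modal .nat (.lam .modal .nat (.app (stepsTm K k) (.var 1))))
      (.arr .modal .nat (.arr .modal .nat (.arr .nonmodal (.base cfgTy) (.base cfgTy)))) := by
  have hΓ := (Ctx.base_empty.cons .modal .nat).cons .nonmodal cfgTy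
  refine ⟨.lam (.lam ?_), .lam (.lam (.app_modal_var rfl (h.closed _)))⟩
  have h' := Typed.app_modal_var (Γ := (Ctx.empty.cons .modal .nat).cons .nonmodal (.base cfgTy))
    (i := 1) rfl (h.closed _)
  exact .app_shared hΓ (Ctx.le_nonmodal _) h' (.app_shared hΓ (Ctx.le_nonmodal _) h' (.var rfl))

theorem typed_stepsTm (k : ℕ) : Typed .empty (stepsTm K k)
    (.arr .modal .nat (.arr .nonmodal (.base cfgTy) (.base cfgTy))) := by
  induction k with
  | zero => exact .lam ((typed_stepTm K).closed _)
  | succ k ih => exact typed_loopTm (typed_stepsTm_succ K k ih).1 (typed_stepsTm_succ K k ih).2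

theorem loop_runFrom (a b : ℕ) (n : ℕ) (c : Cfg Q S) :
    loop (fun c => M.runFrom c a) (fun _ c => M.runFrom c b) n c =
      M.runFrom c (a + n.size * b) := by
  induction n using Nat.strong_induction_on generalizing c with
  | _ n ih =>
    rw [loop]
    split_ifs with hn
    · simp [hn]
    · have hs := Nat.size_eq_size_half_add_one hn
      rw [show a + n.size * b = b + (a + (n / 2).size * b) by rw [hs]; ring, Machine.runFrom_add]
      congr 1
      funext d
      exact ih _ (Nat.div_lt_self (Nat.pos_of_ne_zero hn) one_lt_two) d

theorem ev_stepsTm (k n : ℕ) (c : Cfg Q S) :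
    Ev (encode K) (.app (.app (stepsTm K k) (.num n)) (encode K c))
      (M.runFrom c ((n.size + 2) ^ k)) := by
  induction k generalizing c with
  | zero =>
    rw [pow_zero, Machine.runFrom_one]
    refine ((Ev.beta_num _ n).appL _).of_pure ?_
    simpa [Tm.inst, (typed_stepTm K).isClosed _] using ev_stepTm K c
  | succ k ih =>
    have hc := (typed_stepsTm K k).isClosed
    have h := typed_stepsTm_succ K k (typed_stepsTm K k)
    have := ev_loopTm (G := cfgTy) (n := n) h.1.isClosed h.2.isClosed (value_encode K)
      (β := fun c => M.runFrom c ((n.size + 2) ^ k + (n.size + 2) ^ k))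
      (φ := fun _ c => M.runFrom c ((n.size + 2) ^ k)) ?_ ?_ c
    · rw [loop_runFrom] at this
      -- Two runs at the end of the loop and one per round add up to the next power.
      rwa [show (n.size + 2) ^ k + (n.size + 2) ^ k + n.size * (n.size + 2) ^ k =
        (n.size + 2) ^ (k + 1) by ring] at this
    · intro c
      refine ((Ev.beta_num _ n).appL _).of_pure (.beta (value_encode K c) ?_)
      rw [Machine.runFrom_add]
      simpa [Tm.inst, Tm.subst, hc _, Tm.single, Tm.upSubst, Tm.rename] using
        ((ih c).appR (.app (stepsTm K k) (.num n))).bind fun d _ => ih d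
    · intro x c
      refine (((Ev.beta_num _ n).appL _).appL _).of_pure (((Ev.beta_num _ x).appL _).of_pure ?_)
      simpa [Tm.inst, Tm.subst, hc _, Tm.single, Tm.upSubst, Tm.rename] using ih c

/-! ### Input and output -/

/-- The digits of `n` pushed to a tape. -/
noncomputable def inputTm : Tm :=
  loopTm .nat (.lam .modal .nat (.lam .nonmodal .nat (.var 0)))
    (.lam .modal .nat (.lam .modal .nat (.lam .nonmodal .nat (.caseOf .nat (.var 1) (.var 0)
      (pushTm K.width (K.symbol (M.digit false)) (.var 0))
      (pushTm K.width (K.symbol (M.digit true)) (.var 0))))))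

theorem typed_input_parts : Typed .empty (.lam .modal .nat (.lam .nonmodal .nat (.var 0)))
      (.arr .modal .nat (.arr .nonmodal .nat .nat)) ∧
    Typed .empty (.lam .modal .nat (.lam .modal .nat (.lam .nonmodal .nat
      (.caseOf .nat (.var 1) (.var 0) (pushTm K.width (K.symbol (M.digit false)) (.var 0))
        (pushTm K.width (K.symbol (M.digit true)) (.var 0))))))
      (.arr .modal .nat (.arr .modal .nat (.arr .nonmodal .nat .nat))) := by
  have hΓ := ((Ctx.base_empty.cons .modal .nat).cons .modal .nat).cons .nonmodal .nat
  exact ⟨.lam (.lam (.var rfl)), .lam (.lam (.lam (.caseOf_shared hΓ trivial (.var rfl)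
    (.var rfl) (.pushTm hΓ _ _ (.var rfl)) (.pushTm hΓ _ _ (.var rfl)))))⟩

theorem typed_inputTm : Typed .empty (inputTm K) (.arr .modal .nat (.arr .nonmodal .nat .nat)) :=
  typed_loopTm (typed_input_parts K).1 (typed_input_parts K).2

/-- The tape with one more digit of the input, the lowest bit of `x`. -/
def pushDigit (x a : ℕ) : ℕ :=
  if x = 0 then a else a * 2 ^ K.width + K.symbol (M.digit (decide (x % 2 = 1)))

/-- The loop meets the bits from the lowest upwards and pushes each in front, so the most
significant digit ends up first. -/
theorem loop_pushDigit (n : ℕ) (l : List S) :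
    loop PMF.pure (fun x a => PMF.pure (pushDigit K x a)) n (K.list l) =
      PMF.pure (K.list (M.input n ++ l)) := by
  induction n using Nat.strong_induction_on generalizing l with
  | _ n ih =>
    rw [loop]
    split_ifs with hn
    · simp [hn, Machine.input]
    · have h := ih (n / 2) (Nat.div_lt_self (Nat.pos_of_ne_zero hn) one_lt_two)
        (M.digit (decide (n % 2 = 1)) :: l)
      rw [PMF.pure_bind, pushDigit, if_neg hn]
      have hb : n.bits = decide (n % 2 = 1) :: (n / 2).bits := by
        rcases Nat.even_or_odd' n with ⟨j, rfl | rfl⟩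
        · rw [Nat.bit0_bits _ (by omega)]; simp
        · rw [Nat.bit1_bits, show (2 * j + 1) / 2 = j by omega]; simp
      rw [Machine.Coding.list] at h
      rw [h]
      simp [Machine.input, hb]

theorem ev_inputTm (n : ℕ) :
    Ev num (.app (.app (inputTm K) (.num n)) (.num 0)) (PMF.pure (K.list (M.input n))) := by
  have := ev_loopTm (G := .nat) (n := n) (typed_input_parts K).1.isClosed (typed_input_parts K).2.isClosed
    Value.num (β := PMF.pure) (φ := fun x a => PMF.pure (pushDigit K x a)) ?_ ?_ 0
  · have e := loop_pushDigit K n []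
    rw [Machine.Coding.list, List.append_nil] at e
    rwa [e] at this
  · intro a
    refine ((Ev.beta_num _ n).appL _).of_pure (.beta (.num a) ?_)
    exact .ret (f := num) a
  · intro x a
    refine (((Ev.beta_num _ n).appL _).appL _).of_pure
      (((Ev.beta_num _ x).appL _).of_pure (.beta (.num a) ?_))
    simp only [Tm.inst, Tm.subst, subst_pushTm, Tm.single, Tm.upSubst, Tm.rename]
    have hp : ∀ s, Ev num (pushTm K.width (K.symbol s) (.num a)) _ := fun s =>
      (Ev.ret a).pushTm _ _ (K.symbol_lt s)
    rw [pushDigit]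
    rcases Nat.even_or_odd' x with ⟨j, rfl | rfl⟩
    · rcases Nat.eq_zero_or_pos j with rfl | hj
      -- A loop never calls its body at 0, but `ev_loopTm` asks for all `x`; `pushDigit` matches the
      -- zero branch here.
      · exact .of_red (.caseZero _ _ _ _) (.ret (f := num) a)
      · rw [if_neg (by omega)]
        simpa using Ev.of_red (.caseEven _ j _ _ _ hj.ne') (hp _)
    · rw [if_neg (by omega)]
      simpa [Nat.mul_add_mod] using Ev.of_red (.caseOdd _ j _ _ _) (hp _)

/-- The initial configuration with a given tape. -/
noncomputable def initTm : Tm :=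
  .lam .nonmodal .nat (quad (.num (K.state M.start)) (topTm K.width (.var 0)) (.num 0)
    (popTm K.width (.var 0)))

theorem typed_initTm : Typed .empty (initTm K) (.arr .nonmodal .nat (.base cfgTy)) := by
  have hΓ := Ctx.base_empty.cons .nonmodal .nat
  exact .lam (.quad hΓ (.cst _) (.topTm hΓ _ (.var rfl)) (.cst _) (.popTm hΓ _ (.var rfl)))

theorem ev_initTm (n : ℕ) :
    Ev (encode K) (.app (initTm K) (.num (K.list (M.input n)))) (PMF.pure (M.initial n)) := by
  refine .beta (.num _) ?_
  simp only [Tm.inst, quad, Tm.subst, subst_topTm, subst_popTm, Tm.single]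
  refine .quad (.ret _) ((Ev.ret _).topTm _) (.ret 0) ((Ev.ret _).popTm _) ?_
  rw [K.list_mod, K.list_div]
  exact .ret (f := encode K) (M.initial n)

/-- The tape from the head to the right. -/
noncomputable def tapeTm : Tm :=
  .lam .nonmodal (.base cfgTy) (dispatch .nat K.width (headOf (.var 0)) fun k =>
    pushTm K.width k (rightOf (.var 0)))

theorem typed_tapeTm : Typed .empty (tapeTm K) (.arr .nonmodal (.base cfgTy) .nat) := by
  have hΓ := Ctx.base_empty.cons .nonmodal cfgTy
  exact .lam (.dispatch hΓ (A := .nat) trivial _ (.headOf (.var rfl)) fun _ =>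
    .pushTm hΓ _ _ (.rightOf (.var rfl)))

theorem ev_tapeTm (c : Cfg Q S) :
    Ev num (.app (tapeTm K) (encode K c)) (PMF.pure (K.list (c.head :: c.right))) := by
  refine .beta (value_encode K c) ?_
  rw [Tm.inst, subst_dispatch]
  refine .dispatch _ _ (ev_headOf _ _ _ _) ?_
  rw [Nat.mod_eq_of_lt (K.symbol_lt _), subst_pushTm]
  exact (ev_rightOf _ _ _ _).pushTm _ _ (K.symbol_lt _)

/-- One step of reading the result. -/
def readBody (c : Tm) : Tm :=
  dispatch (.base (.prod .nat .nat)) K.width (.fst c) fun k =>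
    if k = K.symbol (M.digit false) then
      .pair (popTm K.width (.fst c)) (.app (.cst .S0) (.snd c))
    else if k = K.symbol (M.digit true) then
      .pair (popTm K.width (.fst c)) (.app (.cst .S1) (.snd c))
    else c

def readTm : Tm := .lam .nonmodal (.base (.prod .nat .nat)) (readBody K (.var 0))

theorem typed_readTm : Typed .empty (readTm K)
    (.arr .nonmodal (.base (.prod .nat .nat)) (.base (.prod .nat .nat))) := by
  have hΓ := Ctx.base_empty.cons .nonmodal (.prod .nat .nat)
  refine .lam (.dispatch hΓ (A := .base (.prod .nat .nat)) trivial _ (.fst (F := .nat) (.var rfl)) fun k => ?_)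
  split_ifs
  · exact .pair_shared hΓ (.popTm hΓ _ (.fst (F := .nat) (.var rfl)))
      (.app_cst hΓ rfl (.snd (G := .nat) (.var rfl)))
  · exact .pair_shared hΓ (.popTm hΓ _ (.fst (F := .nat) (.var rfl)))
      (.app_cst hΓ rfl (.snd (G := .nat) (.var rfl)))
  · exact .var rfl

def encodePair (x : ℕ × ℕ) : Tm := .pair (.num x.1) (.num x.2)

theorem ev_readTm (x : ℕ × ℕ) :
    Ev encodePair (.app (readTm K) (encodePair x)) (PMF.pure (K.readStep x)) := by
  refine .beta (.pair (.num _) (.num _)) ?_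
  rw [Tm.inst, readBody, subst_dispatch]
  have h1 : Ev num (.fst (encodePair x)) _ := ev_fst_num _ _
  have h2 : Ev num (.snd (encodePair x)) _ := ev_snd_num _ _
  refine .dispatch _ _ h1 ?_
  rw [Machine.Coding.readStep]
  split_ifs
  · simp only [Tm.subst, subst_popTm, Tm.single]
    exact ((h1.popTm _).pairL _).of_pure ((h2.S0.pairR _).of_pure (.ret (f := encodePair) (_, _)))
  · simp only [Tm.subst, subst_popTm, Tm.single]
    exact ((h1.popTm _).pairL _).of_pure ((h2.S1.pairR _).of_pure (.ret (f := encodePair) (_, _)))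
  · exact .ret (f := encodePair) x

/-- The reading of the result from a tape. -/
def outputTm : Tm :=
  .lam .modal .nat (.snd (.app (.app (loopTm (.prod .nat .nat) (.lam .modal .nat (readTm K))
    (.lam .modal .nat (.lam .modal .nat (readTm K)))) (.var 0)) (.pair (.var 0) (.num 0))))

theorem typed_output_loop : Typed .empty (loopTm (.prod .nat .nat) (.lam .modal .nat (readTm K))
    (.lam .modal .nat (.lam .modal .nat (readTm K))))
    (.arr .modal .nat (.arr .nonmodal (.base (.prod .nat .nat)) (.base (.prod .nat .nat)))) :=
  typed_loopTm (.lam ((typed_readTm K).closed _)) (.lam (.lam ((typed_readTm K).closed _)))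

theorem typed_outputTm : Typed .empty (outputTm K) (.arr .modal .nat .nat) := by
  have hΓ := Ctx.base_empty.cons .modal .nat
  exact .lam (.snd (G := .nat) (.app_shared hΓ (Ctx.le_nonmodal _) (.app_modal_var rfl
    ((typed_output_loop K).closed _)) (.pair_shared hΓ (.var rfl) (.cst (.num 0)))))

/-- The base part applies `p` once more after the `n.size` rounds. -/
theorem loop_iterate {α : Type*} (p : α → α) (n : ℕ) (a : α) :
    loop (fun a => PMF.pure (p a)) (fun _ a => PMF.pure (p a)) n a =
      PMF.pure (p^[n.size + 1] a) := by
  induction n using Nat.strong_induction_on generalizing a with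
  | _ n ih =>
    rw [loop]
    split_ifs with hn
    · simp [hn]
    · have hs := Nat.size_eq_size_half_add_one hn
      rw [PMF.pure_bind, ih _ (Nat.div_lt_self (Nat.pos_of_ne_zero hn) one_lt_two), hs]
      rfl

theorem ev_outputTm (l : List S) :
    Ev num (.app (outputTm K) (.num (K.list l))) (PMF.pure (M.readFrom 0 l)) := by
  have hc := (typed_readTm K).isClosed
  have h := ev_loopTm (n := K.list l) (G := .prod .nat .nat) (B := .lam .modal .nat (readTm K))
    (F := .lam .modal .nat (.lam .modal .nat (readTm K))) (fun σ => by simp [Tm.subst, hc _])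
    (fun σ => by simp [Tm.subst, hc _]) (enc := encodePair) (fun x => .pair (.num _) (.num _))
    (β := fun x => PMF.pure (K.readStep x)) (φ := fun _ x => PMF.pure (K.readStep x)) ?_ ?_
    (K.list l, 0)
  · rw [loop_iterate] at h
    rw [← K.readStep_iterate l 0 ((K.list l).size + 1) (Nat.le_succ _)]
    refine .beta (.num _) ?_
    have := h.snd.of_pure (ev_snd_num _ _)
    simpa [Tm.inst, Tm.subst, (typed_output_loop K).isClosed _, Tm.single, encodePair] using this
  · intro x
    refine ((Ev.beta_num _ _).appL _).of_pure ?_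
    simpa [Tm.inst, hc _] using ev_readTm K x
  · intro n x
    refine (((Ev.beta_num _ _).appL _).appL _).of_pure (((Ev.beta_num _ _).appL _).of_pure ?_)
    simpa [Tm.inst, Tm.subst, hc _] using ev_readTm K x

/-- The simulation of the machine for `(|n| + 2) ^ k` steps on input `n`. -/
noncomputable def simTm (k : ℕ) : Tm :=
  .lam .modal .nat (.app (outputTm K) (.app (tapeTm K) (.app (.app (stepsTm K k) (.var 0))
    (.app (initTm K) (.app (.app (inputTm K) (.var 0)) (.num 0))))))

/-- `outputTm` takes a modal argument although the tape is the result of a simulation. The context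
of this argument contains only the modal `n`, so it satisfies the bound for every aspect. -/
theorem typed_simTm (k : ℕ) : Typed .empty (simTm K k) (.arr .modal .nat .nat) := by
  have hΓ := Ctx.base_empty.cons .modal .nat
  have hm : ∀ a, (Ctx.empty.cons .modal .nat).Le a := fun a => (Ctx.le_empty a).cons_modal _
  exact .lam (.app_shared hΓ (hm _) ((typed_outputTm K).closed _) (.app_shared hΓ (hm _)
    ((typed_tapeTm K).closed _) (.app_shared hΓ (hm _) (.app_shared hΓ (hm _)
    ((typed_stepsTm K k).closed _) (.var rfl)) (.app_shared hΓ (hm _) ((typed_initTm K).closed _)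
    (.app_shared hΓ (hm _) (.app_shared hΓ (hm _) ((typed_inputTm K).closed _) (.var rfl))
    (.cst (.num 0)))))))

/-- Input and output are deterministic; only the simulated steps branch, and the output is grafted
on each of their outcomes. -/
theorem ev_simTm (k n : ℕ) :
    Ev num (.app (simTm K k) (.num n)) ((M.run n ((n.size + 2) ^ k)).map M.result) := by
  refine .beta (.num n) ?_
  simp only [Tm.inst, Tm.subst, (typed_outputTm K).isClosed _, (typed_tapeTm K).isClosed _,
    (typed_stepsTm K k).isClosed _, (typed_initTm K).isClosed _, (typed_inputTm K).isClosed _,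
    Tm.single]
  refine (((((ev_inputTm K n).appR _).appR _).appR _).appR _).of_pure ?_
  refine ((((ev_initTm K n).appR _).appR _).appR _).of_pure ?_
  rw [← Machine.runFrom_initial, PMF.map]
  exact (((ev_stepsTm K k n _).appR _).appR _).bind fun c _ =>
    ((ev_tapeTm K c).appR _).of_pure (ev_outputTm K _)

end RSLR

/-! ### Representation of polynomial-time probabilistic machines -/

theorem mainTheorem5 {Q S : Type*} [Finite Q] [Finite S] (M : PTM.Machine Q S)
    (hM : M.IsPolyTime) :
    ∃ t : RSLR.Tm, RSLR.IsFirstOrder 1 t ∧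
      ∀ n : ℕ, RSLR.Eval (.app t (.num n)) ((M.resultDist n (hM.halts n)).map RSLR.Tm.num) := by
  obtain ⟨K⟩ := M.nonempty_coding
  obtain ⟨p, hp⟩ := hM
  obtain ⟨k, hk⟩ := p.exists_eval_le_pow
  refine ⟨RSLR.simTm K k, ⟨[.modal], rfl, RSLR.typed_simTm K k⟩, fun n => ?_⟩
  -- The simulation runs `U` steps beyond the polynomial bound, which do not change the
  -- distribution.
  obtain ⟨U, hU⟩ := Nat.exists_eq_add_of_le (hk n.size)
  have h := RSLR.ev_simTm K k n
  rw [hU, M.run_add_of_haltsWithin (hp n), ← M.resultDist_eq (hp n)] at h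
  exact h.eval RSLR.NF.num
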